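/- A real is a function $\mathbb N\to\mathbb N$. For reals $f,Z$, "$Z$ computes $f$" means $f\le_T Z$; the Turing jump of $Z$ is (the characteristic function of) $Z'=\{e\in\mathbb N:\{e\}^Z(e)\downarrow\}$, where $\{e\}^Z$ is the partial function computed by the $e$-th oracle program with oracle $Z$; and $Z^{(0)}=Z$, $Z^{(n+1)}=(Z^{(n)})'$. A linear ordering $\mathcal X$ with domain a subset of $\mathbb N$ is $Z$-computable if its domain and its order relation are computable from $Z$. A descending sequence in $\mathcal X$ is a function $f\colon\mathbb N\to\mathcal X$ with $f(k+1)<_{\mathcal X}f(k)$ for all $k$. For a linear ordering $\mathcal X$, $\boldsymbol\omega^{\mathcal X}$ is the set of all finite strings $\langle x_0,\dots,x_{k-1}\rangle$ (including the empty one) of elements of $\mathcal X$ with $x_0\ge_{\mathcal X}x_1\ge_{\mathcal X}\dots\ge_{\mathcal X}x_{k-1}$, ordered lexicographically (a proper initial segment of a string precedes it), and coded by natural numbers through a fixed computable coding of finite strings. Let $E_0(\mathcal X)=\mathcal X$ and $E_{n+1}(\mathcal X)=\boldsymbol\omega^{E_n(\mathcal X)}$. **Theorem.** For every $n\in\mathbb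 N$ and every real $Z$ there is a $Z$-computable linear ordering $\mathcal X_Z^n$ such that 1. for every descending sequence $f$ in $\mathcal X_Z^n$ (computable or not), the jump $f'$ computes $Z^{(n)}$; and 2. there is a $Z$-computable descending sequence in $E_n(\mathcal X_Z^n)$. -/

import Mathlib

/-! ### Oracle computation, the Turing jump -/

/-- Programs for partial functions `ℕ →. ℕ` computed with an oracle. -/
inductive OracleCode : Type
  | zero : OracleCode
  | succ : OracleCode
  | left : OracleCode
  | right : OracleCode
  | oracle : OracleCode
  | pair : OracleCode → OracleCode → OracleCode
  | comp : OracleCode → OracleCode → OracleCode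
  | prec : OracleCode → OracleCode → OracleCode
  | rfind' : OracleCode → OracleCode

namespace OracleCode

/-- The partial function computed by a program with oracle `Z`. Apart from the oracle query, the
clauses are those of `Nat.Partrec.Code.eval`. -/
def eval (Z : ℕ → ℕ) : OracleCode → ℕ →. ℕ
  | zero => pure 0
  | succ => Nat.succ
  | left => ↑fun n : ℕ => n.unpair.1
  | right => ↑fun n : ℕ => n.unpair.2
  | oracle => ↑Z
  | pair cf cg => fun n => Nat.pair <$> eval Z cf n <*> eval Z cg n
  | comp cf cg => fun n => eval Z cg n >>= eval Z cf
  | prec cf cg =>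
    Nat.unpaired fun a n =>
      n.rec (eval Z cf a) fun y IH => do
        let i ← IH
        eval Z cg (Nat.pair a (Nat.pair y i))
  | rfind' cf =>
    Nat.unpaired fun a m =>
      (Nat.rfind fun n => (fun x => x = 0) <$> eval Z cf (Nat.pair a (n + m))).map (· + m)

/-- The program with index `e`: an effective enumeration of all programs, by the same coding of
syntax trees as `Nat.Partrec.Code.ofNatCode`. -/
def ofNat : ℕ → OracleCode
  | 0 => zero
  | 1 => succ
  | 2 => left
  | 3 => right
  | 4 => oracle
  | n + 5 =>
    let m := n.div2.div2
    have hm : m < n + 5 := by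
      simp only [m, Nat.div2_val]
      exact lt_of_le_of_lt (le_trans (Nat.div_le_self _ _) (Nat.div_le_self _ _))
        (by omega)
    have _m1 : m.unpair.1 < n + 5 := lt_of_le_of_lt m.unpair_left_le hm
    have _m2 : m.unpair.2 < n + 5 := lt_of_le_of_lt m.unpair_right_le hm
    match n.bodd, n.div2.bodd with
    | false, false => pair (ofNat m.unpair.1) (ofNat m.unpair.2)
    | false, true => comp (ofNat m.unpair.1) (ofNat m.unpair.2)
    | true, false => prec (ofNat m.unpair.1) (ofNat m.unpair.2)
    | true, true => rfind' (ofNat m)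
decreasing_by all_goals assumption

end OracleCode

open Classical in
/-- The characteristic function of a set of natural numbers, as a real. -/
noncomputable def charReal (A : Set ℕ) : ℕ → ℕ := fun n => if n ∈ A then 1 else 0

/-- The Turing jump `Z' = {e | {e}^Z(e)↓}`, as a real. -/
noncomputable def turingJump (Z : ℕ → ℕ) : ℕ → ℕ :=
  charReal {e | ((OracleCode.ofNat e).eval Z e).Dom}

/-- The real `f` is computable from the real `Z` (`f ≤_T Z`). -/
def ComputableFrom (f Z : ℕ → ℕ) : Prop :=
  TuringReducible (f : ℕ →. ℕ) (Z : ℕ →. ℕ)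

/-! ### Linear orderings on sets of natural numbers -/

/-- A linear ordering whose domain is a set of natural numbers (possibly finite or empty). -/
structure CodedLinearOrder where
  carrier : Set ℕ
  le : ℕ → ℕ → Prop
  mem_of_le : ∀ x y, le x y → x ∈ carrier ∧ y ∈ carrier
  le_refl : ∀ x ∈ carrier, le x x
  le_antisymm : ∀ x y, le x y → le y x → x = y
  le_trans : ∀ x y z, le x y → le y z → le x z
  le_total : ∀ x ∈ carrier, ∀ y ∈ carrier, le x y ∨ le y x

namespace CodedLinearOrder

/-- The strict order. -/
def lt (X : CodedLinearOrder) (x y : ℕ) : Prop := X.le x y ∧ x ≠ y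

/-- `X` is `Z`-computable: its domain and its order relation are both computable from `Z`. -/
def IsComputableFrom (X : CodedLinearOrder) (Z : ℕ → ℕ) : Prop :=
  ComputableFrom (charReal X.carrier) Z ∧
    ComputableFrom (charReal {p | X.le p.unpair.1 p.unpair.2}) Z

/-- `f` is an infinite (strictly) descending sequence in `X`. -/
def IsDescending (X : CodedLinearOrder) (f : ℕ → ℕ) : Prop :=
  (∀ k, f k ∈ X.carrier) ∧ ∀ k, X.lt (f (k + 1)) (f k)

/-- The strings `⟨x₀, …, x_{k-1}⟩` of elements of `X` with `x₀ ≥ x₁ ≥ … ≥ x_{k-1}`. -/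
def IsOmegaString (X : CodedLinearOrder) (l : List ℕ) : Prop :=
  (∀ x ∈ l, x ∈ X.carrier) ∧ l.Pairwise fun x y => X.le y x

theorem lt_trans (X : CodedLinearOrder) {x y z : ℕ} (h : X.lt x y) (h' : X.lt y z) :
    X.lt x z := by
  refine ⟨X.le_trans _ _ _ h.1 h'.1, ?_⟩
  rintro rfl
  exact h.2 (X.le_antisymm _ _ h.1 h'.1)

theorem lex_irrefl (X : CodedLinearOrder) (l : List ℕ) : ¬ List.Lex X.lt l l := by
  induction l with
  | nil => intro h; cases h
  | cons a l ih =>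
    intro h
    cases h with
    | cons h => exact ih h
    | rel h => exact h.2 rfl

theorem lex_trans (X : CodedLinearOrder) {l₁ l₂ l₃ : List ℕ} (h : List.Lex X.lt l₁ l₂)
    (h' : List.Lex X.lt l₂ l₃) : List.Lex X.lt l₁ l₃ := by
  induction h generalizing l₃ with
  | nil => cases h' <;> exact List.Lex.nil
  | cons _ ih =>
    cases h' with
    | cons h' => exact List.Lex.cons (ih h')
    | rel h' => exact List.Lex.rel h'
  | rel h =>
    cases h' with
    | cons _ => exact List.Lex.rel h
    | rel h' => exact List.Lex.rel (X.lt_trans h h')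

theorem lex_trichotomy (X : CodedLinearOrder) (l₁ l₂ : List ℕ) (h₁ : ∀ x ∈ l₁, x ∈ X.carrier)
    (h₂ : ∀ x ∈ l₂, x ∈ X.carrier) :
    List.Lex X.lt l₁ l₂ ∨ l₁ = l₂ ∨ List.Lex X.lt l₂ l₁ := by
  induction l₁ generalizing l₂ with
  | nil =>
    cases l₂ with
    | nil => exact Or.inr (Or.inl rfl)
    | cons b l₂ => exact Or.inl List.Lex.nil
  | cons a l₁ ih =>
    cases l₂ with
    | nil => exact Or.inr (Or.inr List.Lex.nil)
    | cons b l₂ =>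
      simp only [List.mem_cons, forall_eq_or_imp] at h₁ h₂
      by_cases hab : a = b
      · subst hab
        rcases ih l₂ h₁.2 h₂.2 with h | h | h
        · exact Or.inl (List.Lex.cons h)
        · exact Or.inr (Or.inl (by rw [h]))
        · exact Or.inr (Or.inr (List.Lex.cons h))
      · rcases X.le_total a h₁.1 b h₂.1 with h | h
        · exact Or.inl (List.Lex.rel ⟨h, hab⟩)
        · exact Or.inr (Or.inr (List.Lex.rel ⟨h, fun e => hab e.symm⟩))

/-- The linear ordering `ω^X`: the nonincreasing finite strings in `X`, ordered
lexicographically (a proper initial segment of a string precedes it). A string is represented by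
its code under Mathlib's computable bijection between `ℕ` and `List ℕ`. -/
def omegaExp (X : CodedLinearOrder) : CodedLinearOrder where
  carrier := {a | X.IsOmegaString (Denumerable.ofNat (List ℕ) a)}
  le a b :=
    X.IsOmegaString (Denumerable.ofNat (List ℕ) a) ∧
    X.IsOmegaString (Denumerable.ofNat (List ℕ) b) ∧
    (a = b ∨ List.Lex X.lt (Denumerable.ofNat (List ℕ) a) (Denumerable.ofNat (List ℕ) b))
  mem_of_le _ _ h := ⟨h.1, h.2.1⟩
  le_refl _ h := ⟨h, h, Or.inl rfl⟩
  le_antisymm a b := by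
    rintro ⟨_, _, h⟩ ⟨_, _, h'⟩
    rcases h with h | h
    · exact h
    · rcases h' with h' | h'
      · exact h'.symm
      · exact absurd (X.lex_trans h h') (X.lex_irrefl _)
  le_trans a b c := by
    rintro ⟨ha, _, h⟩ ⟨_, hc, h'⟩
    refine ⟨ha, hc, ?_⟩
    rcases h with rfl | h
    · exact h'
    · rcases h' with rfl | h'
      · exact Or.inr h
      · exact Or.inr (X.lex_trans h h')
  le_total a ha b hb := by
    rcases X.lex_trichotomy _ _ ha.1 hb.1 with h | h | h
    · exact Or.inl ⟨ha, hb, Or.inr h⟩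
    · refine Or.inl ⟨ha, hb, Or.inl ?_⟩
      have := congrArg Encodable.encode h
      simpa using this
    · exact Or.inr ⟨hb, ha, Or.inr h⟩

end CodedLinearOrder

/-! ### Relative computability -/

section Relative

variable {α β γ σ : Type*} [Primcodable α] [Primcodable β] [Primcodable γ] [Primcodable σ]
variable {O : Set (ℕ →. ℕ)}

/-! The ordering is the Kleene-Brouwer order of a `Z`-computable tree `T` over a well-ordered
alphabet, chosen so that every path through `T` computes the `n`th jump of `Z`. A descending
sequence `f` in such an order converges symbol by symbol to a path, because the alphabet is
well-founded; whether a prefix has settled by a given stage is a Π₁ question about `f`, so `f'`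
computes the path (`exists_path_of_isDescending`). This is the only jump of `f` spent, whatever `n`
is.

The tree is built by induction on `n` (`exists_jumpTree`), starting from the tree of initial
segments of `Z`. Given `T`, the tree `jumpTree H T` consists of finite approximations to the jumps
of the strings in `T`. Position `i` holds `inr x` while program `i` has not been seen to halt, and
`inl` of the string at which halting was noticed afterwards; each such discovery erases everything
to its right. A path through this tree yields a path `P` through `T` and decides the jump of `P`
(`exists_path_of_jumpTree`), so it computes one more jump of `Z`.

The price is one exponential. Reading a string of `T` symbol by symbol makes its approximation
descend in the Kleene-Brouwer order of the jump tree: appending a symbol moves down, and so does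
turning an `inr` into an `inl`. The list of all approximations met is thus an element of the
exponential, and this gives an increasing map from the order of `T` (`isPrimrecEmbedding_jumpTree`).
Exponentiation respects increasing maps, so a descending sequence in `E_n` of the old order becomes
one in `E_{n+1}` of the new order.

The halting test `H` comes from `exists_primrecRel_jump`: a primitive recursive relation on finite
pieces of the oracle, monotone under extension. -/

theorem RecursiveIn.comp {f : β →. σ} {g : α → β} (hf : RecursiveIn O f)
    (hg : ComputableIn O g) : RecursiveIn O fun a => f (g a) := by
  refine (Nat.RecursiveIn.comp hf hg).of_eq fun n => ?_
  cases h : (Encodable.decode n : Option α) <;> simp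

theorem ComputableIn.comp {f : β → σ} {g : α → β} (hf : ComputableIn O f)
    (hg : ComputableIn O g) : ComputableIn O fun a => f (g a) :=
  RecursiveIn.comp (f := fun b => Part.some (f b)) hf hg

theorem ComputableIn.pair {f : α → β} {g : α → γ} (hf : ComputableIn O f)
    (hg : ComputableIn O g) : ComputableIn O fun a => (f a, g a) := by
  refine (Nat.RecursiveIn.pair hf hg).of_eq fun n => ?_
  cases h : (Encodable.decode n : Option α) <;> simp [Seq.seq]

theorem ComputableIn.of_eq {f g : α → σ} (hf : ComputableIn O f) (h : ∀ a, f a = g a) :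
    ComputableIn O g :=
  (funext h : f = g) ▸ hf

theorem ComputableIn.subst {O' : Set (ℕ →. ℕ)} {f : α → σ} (hf : ComputableIn O f)
    (h : ∀ g ∈ O, RecursiveIn O' g) : ComputableIn O' f :=
  RecursiveIn.subst hf h

theorem ComputableIn.trans {f : α → σ} {Y Z : ℕ → ℕ}
    (hf : ComputableIn {(Y : ℕ →. ℕ)} f) (h : ComputableFrom Y Z) :
    ComputableIn {(Z : ℕ →. ℕ)} f :=
  hf.subst (by rintro g rfl; exact h)

theorem computableIn_self (Z : ℕ → ℕ) : ComputableIn {(Z : ℕ →. ℕ)} Z :=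
  RecursiveIn.oracle _ rfl

theorem ComputableFrom.computableIn {f Z : ℕ → ℕ} (h : ComputableFrom f Z) :
    ComputableIn {(Z : ℕ →. ℕ)} f := h

theorem computableFrom_iff_encode {f : ℕ → σ} {Z : ℕ → ℕ} :
    ComputableFrom (fun n => Encodable.encode (f n)) Z ↔ ComputableIn {(Z : ℕ →. ℕ)} f := by
  show Nat.RecursiveIn _ _ ↔ Nat.RecursiveIn _ _
  refine iff_of_eq (congrArg _ (funext fun n => ?_))
  simp

theorem ComputableIn.nat_rec {f : ℕ → σ} {g : ℕ × σ → σ} (hg : ComputableIn O g)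
    (h : ∀ n, f (n + 1) = g (n, f n)) : ComputableIn O f := by
  have h0 : Nat.RecursiveIn O fun _ => Part.some (Encodable.encode (f 0)) := by
    simpa using RecursiveIn.iff_nat.1
      (ComputableIn.const (O := O) (α := ℕ) (Encodable.encode (f 0))).recursiveIn
  have hs : Nat.RecursiveIn O fun n => Part.bind
      (Part.ofOption (Encodable.decode (α := ℕ × ℕ × σ) n)) fun a => Part.some (Encodable.encode (g a.2)) := by
    have := RecursiveIn.comp (f := fun a => Part.some (g a)) hg
      (ComputableIn.snd (O := O) (α := ℕ) (β := ℕ × σ))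
    simpa [RecursiveIn] using this
  have hp := (Nat.RecursiveIn.prec h0 hs)
  -- Primitive recursion on codes carries a parameter; `0` is a dummy value for it.
  have h1 : ComputableIn O (fun n : ℕ => Nat.pair 0 n) :=
    (Primrec₂.natPair.comp (Primrec.const 0) Primrec.id).computableIn
  have h2 := RecursiveIn.comp (RecursiveIn.iff_nat.2 hp) h1
  have : RecursiveIn O fun n => Part.some (Encodable.encode (f n)) := by
    refine h2.of_eq fun n => ?_
    simp only [Nat.unpair_pair]
    induction n with
    | zero => rfl
    | succ n ih =>
      simp only [ih]
      simp [h]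
  refine (RecursiveIn.iff_nat.1 this).of_eq fun n => ?_
  simp

theorem computableIn_map_range {P : ℕ → σ} (hP : ComputableIn O P) :
    ComputableIn O fun k => (List.range k).map P :=
  ComputableIn.nat_rec (g := fun p : ℕ × List σ => p.2 ++ [P p.1])
    (Primrec.list_concat.computableIn.comp (ComputableIn.snd.pair (hP.comp ComputableIn.fst)))
    fun n => by simp [List.range_succ]

/-- A predicate is decidable in `O` if its truth value is computable in `O`. -/
def DecidableIn (O : Set (ℕ →. ℕ)) (p : α → Prop) : Prop :=
  ∃ _ : DecidablePred p, ComputableIn O fun a => decide (p a)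

theorem DecidableIn.decide {p : α → Prop} [DecidablePred p] (h : DecidableIn O p) :
    ComputableIn O fun a => decide (p a) := by
  convert! h.choose_spec

theorem PrimrecPred.decidableIn {p : α → Prop} (h : PrimrecPred p) : DecidableIn O p :=
  ⟨h.choose, h.choose_spec.computableIn⟩

theorem DecidableIn.of_iff {p q : α → Prop} (h : DecidableIn O p) (H : ∀ a, p a ↔ q a) :
    DecidableIn O q :=
  (funext fun a => propext (H a) : p = q) ▸ h

theorem DecidableIn.comp {p : β → Prop} {f : α → β} (h : DecidableIn O p)
    (hf : ComputableIn O f) : DecidableIn O fun a => p (f a) :=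
  ⟨fun a => h.choose (f a), h.choose_spec.comp hf⟩

theorem DecidableIn.and {p q : α → Prop} (hp : DecidableIn O p) (hq : DecidableIn O q) :
    DecidableIn O fun a => p a ∧ q a := by
  classical
  exact ⟨inferInstance, ((Primrec.and.computableIn (O := O)).comp (hp.decide.pair hq.decide)).of_eq
    fun a => by simp⟩

theorem DecidableIn.not {p : α → Prop} (hp : DecidableIn O p) :
    DecidableIn O fun a => ¬ p a := by
  classical
  exact ⟨inferInstance, ((Primrec.not.computableIn (O := O)).comp hp.decide).of_eq
    fun a => by simp⟩

theorem DecidableIn.subst {O' : Set (ℕ →. ℕ)} {p : α → Prop} (hp : DecidableIn O p)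
    (h : ∀ g ∈ O, RecursiveIn O' g) : DecidableIn O' p :=
  ⟨hp.choose, hp.choose_spec.subst h⟩

theorem DecidableIn.trans {p : α → Prop} {Y Z : ℕ → ℕ}
    (hp : DecidableIn {(Y : ℕ →. ℕ)} p) (h : ComputableFrom Y Z) :
    DecidableIn {(Z : ℕ →. ℕ)} p :=
  hp.subst (by rintro g rfl; exact h)

theorem decidableIn_iff_charReal {A : Set ℕ} {Z : ℕ → ℕ} :
    DecidableIn {(Z : ℕ →. ℕ)} (fun n => n ∈ A) ↔ ComputableFrom (charReal A) Z := by
  classical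
  constructor
  · intro h
    refine (((Primrec.encode (α := Bool)).computableIn).comp h.decide).of_eq fun n => ?_
    by_cases hn : n ∈ A <;> simp [charReal, hn]
  · intro h
    refine ⟨inferInstance, (((Primrec.eq (α := ℕ)).decide.computableIn (O := _)).comp
      (h.computableIn.pair (ComputableIn.const 1))).of_eq fun n => ?_⟩
    by_cases hn : n ∈ A <;> simp [charReal, hn]

theorem DecidableIn.rfind {R : α → ℕ → Prop}
    (h : DecidableIn O fun q : α × ℕ => R q.1 q.2) :
    ∃ g : α →. ℕ, RecursiveIn O g ∧ (∀ a, (g a).Dom ↔ ∃ n, R a n) ∧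
      ∀ a, ∀ n ∈ g a, R a n := by
  classical
  -- The search operator looks for a zero, so truth is coded by `0` here.
  have h1 : Nat.RecursiveIn O (fun m => Part.bind (Part.ofOption (Encodable.decode (α := α × ℕ) m))
      fun q => Part.some (if R q.1 q.2 then 0 else 1)) := by
    have : ComputableIn O fun q : α × ℕ => if R q.1 q.2 then 0 else 1 :=
      (((Primrec.cond Primrec.id (Primrec.const 0) (Primrec.const 1)).computableIn (O := O)).comp
        h.decide).of_eq fun q => by by_cases hq : R q.1 q.2 <;> simp [hq]
    simpa [ComputableIn, RecursiveIn, apply_ite] using this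
  refine ⟨fun a => Nat.rfind fun n => Part.some (Decidable.decide (R a n)), ?_, ?_, ?_⟩
  · have h2 := Nat.RecursiveIn.rfind h1
    have h3 : Nat.RecursiveIn O fun n => (Part.ofOption (Encodable.decode (α := α) n)).map
        Encodable.encode := by
      simpa [ComputableIn, RecursiveIn, Part.map_some, Part.bind_some_eq_map] using
        (ComputableIn.id (O := O) (α := α)).recursiveIn
    refine (Nat.RecursiveIn.comp h2 h3).of_eq fun n => ?_
    cases h : (Encodable.decode n : Option α) with
    | none => simp
    | some a =>
      simp only [Part.coe_some, Part.map_some, Part.bind_eq_bind, Part.bind_some]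
      simp only [Encodable.decode_prod_val, Nat.unpair_pair, Encodable.encodek, Option.bind_some,
        Encodable.decode_nat, Option.map_some, Part.coe_some, Part.bind_some]
      simp [Part.map_id']
  · intro a
    refine Nat.rfind_dom.trans ?_
    simp
  · intro a n hn
    simpa using (Nat.mem_rfind.1 hn).1

theorem DecidableIn.exists_choice {R : α → ℕ → Prop}
    (h : DecidableIn O fun q : α × ℕ => R q.1 q.2) (hR : ∀ a, ∃ n, R a n) :
    ∃ f : α → ℕ, ComputableIn O f ∧ ∀ a, R a (f a) := by
  obtain ⟨g, hg, hd, hm⟩ := h.rfind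
  refine ⟨fun a => (g a).get ((hd a).2 (hR a)), ?_, fun a => hm a _ (Part.get_mem _)⟩
  exact RecursiveIn.of_eq hg fun a => (Part.some_get _).symm

end Relative

/-! ### Indices of oracle programs and the jump -/

namespace OracleCode

/-- The index of a program, inverse to `OracleCode.ofNat`. -/
def toNat : OracleCode → ℕ
  | zero => 0
  | succ => 1
  | left => 2
  | right => 3
  | oracle => 4
  | pair cf cg => 2 * (2 * Nat.pair cf.toNat cg.toNat) + 5
  | comp cf cg => 2 * (2 * Nat.pair cf.toNat cg.toNat + 1) + 5
  | prec cf cg => (2 * (2 * Nat.pair cf.toNat cg.toNat) + 1) + 5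
  | rfind' cf => (2 * (2 * cf.toNat + 1) + 1) + 5

theorem ofNat_toNat (c : OracleCode) : ofNat c.toNat = c := by
  induction c with
  | zero | succ | left | right | oracle => simp [toNat, ofNat]
  | pair cf cg hf hg | comp cf cg hf hg | prec cf cg hf hg =>
    simp [toNat, ofNat, Nat.div2_val, hf, hg]
  | rfind' cf hf => simp [toNat, ofNat, Nat.div2_val, hf]

/-- The program for the constant function with value `n`. -/
def const : ℕ → OracleCode
  | 0 => zero
  | n + 1 => comp succ (const n)

theorem eval_const (Z : ℕ → ℕ) (n m : ℕ) : eval Z (const n) m = Part.some n := by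
  induction n with
  | zero => rfl
  | succ n ih =>
    simp only [const, eval, ih]
    exact Part.bind_some n _

theorem primrec_toNat_const : Primrec fun n => (const n).toNat := by
  have : Primrec₂ fun (_ : ℕ) (p : ℕ × ℕ) => 2 * (2 * Nat.pair 1 p.2 + 1) + 5 :=
    (Primrec.nat_add.comp (Primrec.nat_mul.comp (Primrec.const 2) (Primrec.succ.comp
      (Primrec.nat_mul.comp (Primrec.const 2) (Primrec₂.natPair.comp (Primrec.const 1)
        (Primrec.snd.comp Primrec.snd))))) (Primrec.const 5)).to₂
  refine (Primrec.nat_rec' Primrec.id (Primrec.const 0) this).of_eq fun n => ?_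
  induction n with
  | zero => rfl
  | succ n ih => simp only [id] at ih ⊢; simp [ih, const, toNat]

theorem exists_eval_eq {f : ℕ → ℕ} {g : ℕ →. ℕ}
    (hg : Nat.RecursiveIn {(f : ℕ →. ℕ)} g) : ∃ c, eval f c = g := by
  induction hg with
  | zero => exact ⟨zero, rfl⟩
  | succ => exact ⟨succ, rfl⟩
  | left => exact ⟨left, rfl⟩
  | right => exact ⟨right, rfl⟩
  | oracle g hg => exact ⟨oracle, hg.symm⟩
  | pair _ _ hf hg =>
    obtain ⟨cf, rfl⟩ := hf
    obtain ⟨cg, rfl⟩ := hg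
    exact ⟨pair cf cg, rfl⟩
  | comp _ _ hf hg =>
    obtain ⟨cf, rfl⟩ := hf
    obtain ⟨cg, rfl⟩ := hg
    exact ⟨comp cf cg, rfl⟩
  | prec _ _ hf hg =>
    obtain ⟨cf, rfl⟩ := hf
    obtain ⟨cg, rfl⟩ := hg
    exact ⟨prec cf cg, rfl⟩
  | rfind _ hf =>
    obtain ⟨cf, rfl⟩ := hf
    -- `pair left right` is the identity program, and `zero` makes the search start at `0`.
    refine ⟨comp (rfind' cf) (pair (pair left right) zero), ?_⟩
    simp [eval, Seq.seq, pure, PFun.pure, Part.map_id']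
    rfl

end OracleCode

theorem turingJump_eq_one_iff {f : ℕ → ℕ} {e : ℕ} :
    turingJump f e = 1 ↔ ((OracleCode.ofNat e).eval f e).Dom := by
  simp [turingJump, charReal]

/-- A program that ignores its input and searches for a witness for the hard-wired `a` halts on its
own index exactly if a witness exists, and that index is primitive recursive in `a`. -/
theorem DecidableIn.exists_jump {α : Type*} [Primcodable α] {f : ℕ → ℕ} {R : α → ℕ → Prop}
    (h : DecidableIn {(f : ℕ →. ℕ)} fun q : α × ℕ => R q.1 q.2) :
    DecidableIn {(turingJump f : ℕ →. ℕ)} fun a => ∃ n, R a n := by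
  obtain ⟨g, hg, hd, -⟩ := h.rfind
  obtain ⟨c, hc⟩ := OracleCode.exists_eval_eq hg
  let e (a : α) : ℕ := (c.comp (.const (Encodable.encode a))).toNat
  have he : Primrec e :=
    (Primrec.nat_add.comp (Primrec.nat_mul.comp (Primrec.const 2) (Primrec.succ.comp
      (Primrec.nat_mul.comp (Primrec.const 2) (Primrec₂.natPair.comp (Primrec.const c.toNat)
        (OracleCode.primrec_toNat_const.comp Primrec.encode))))) (Primrec.const 5))
  have h1 : DecidableIn {(turingJump f : ℕ →. ℕ)} fun a => turingJump f (e a) = 1 :=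
    (PrimrecRel.comp Primrec.eq Primrec.id (Primrec.const 1)).decidableIn.comp
      ((computableIn_self _).comp he.computableIn)
  refine h1.of_iff fun a => ?_
  rw [turingJump_eq_one_iff, ← hd, OracleCode.ofNat_toNat]
  simp [OracleCode.eval, OracleCode.eval_const, hc]

/-- The jump decides the graph of `f`, by `DecidableIn.exists_jump` with a vacuous quantifier; a
search then finds the value. -/
theorem computableFrom_turingJump (f : ℕ → ℕ) : ComputableFrom f (turingJump f) := by
  have h : DecidableIn {(f : ℕ →. ℕ)} fun q : (ℕ × ℕ) × ℕ => f q.1.1 = q.1.2 :=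
    (Primrec.eq (α := ℕ)).decidableIn.comp (f := fun q : (ℕ × ℕ) × ℕ => (f q.1.1, q.1.2))
      (((computableIn_self f).comp (Primrec.fst.comp Primrec.fst).computableIn).pair
        (Primrec.snd.comp Primrec.fst).computableIn)
  have h' : DecidableIn {(turingJump f : ℕ →. ℕ)} fun q : ℕ × ℕ => f q.1 = q.2 :=
    (DecidableIn.exists_jump (R := fun q _ => f q.1 = q.2) h).of_iff fun q => by simp
  obtain ⟨g, hg, hfg⟩ := h'.exists_choice fun n => ⟨f n, rfl⟩
  exact hg.of_eq fun n => (hfg n).symm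

/-! ### A universal approximation to the jump -/

namespace OracleCode

/-- The partial function computed by a program with a partial oracle. -/
def evalPart (O : ℕ →. ℕ) : OracleCode → ℕ →. ℕ
  | zero => pure 0
  | succ => Nat.succ
  | left => ↑fun n : ℕ => n.unpair.1
  | right => ↑fun n : ℕ => n.unpair.2
  | oracle => O
  | pair cf cg => fun n => Nat.pair <$> evalPart O cf n <*> evalPart O cg n
  | comp cf cg => fun n => evalPart O cg n >>= evalPart O cf
  | prec cf cg =>
    Nat.unpaired fun a n =>
      n.rec (evalPart O cf a) fun y IH => do
        let i ← IH
        evalPart O cg (Nat.pair a (Nat.pair y i))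
  | rfind' cf =>
    Nat.unpaired fun a m =>
      (Nat.rfind fun n => (fun x => x = 0) <$> evalPart O cf (Nat.pair a (n + m))).map (· + m)

theorem evalPart_coe (Z : ℕ → ℕ) (c : OracleCode) : evalPart Z c = eval Z c := by
  induction c with
  | zero | succ | left | right | oracle => rfl
  | pair cf cg hf hg | comp cf cg hf hg | prec cf cg hf hg => rw [evalPart, eval, hf, hg]
  | rfind' cf hf => rw [evalPart, eval, hf]

section Membership

variable {O : ℕ →. ℕ} {cf cg : OracleCode} {a k n m v : ℕ}

theorem mem_evalPart_pair : v ∈ evalPart O (pair cf cg) n ↔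
    ∃ x ∈ evalPart O cf n, ∃ y ∈ evalPart O cg n, v = Nat.pair x y := by
  simp [evalPart, Seq.seq, eq_comm]

theorem mem_evalPart_comp : v ∈ evalPart O (comp cf cg) n ↔
    ∃ x ∈ evalPart O cg n, v ∈ evalPart O cf x :=
  Part.mem_bind_iff

theorem evalPart_prec_zero :
    evalPart O (prec cf cg) (Nat.pair a 0) = evalPart O cf a := by
  simp only [evalPart, Nat.unpaired, Nat.unpair_pair]
  rfl

theorem evalPart_prec_succ : evalPart O (prec cf cg) (Nat.pair a (k + 1)) =
    (evalPart O (prec cf cg) (Nat.pair a k)).bind fun i =>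
      evalPart O cg (Nat.pair a (Nat.pair k i)) := by
  simp only [evalPart, Nat.unpaired, Nat.unpair_pair, Part.bind_eq_bind]

theorem mem_evalPart_prec_succ : v ∈ evalPart O (prec cf cg) (Nat.pair a (k + 1)) ↔
    ∃ i ∈ evalPart O (prec cf cg) (Nat.pair a k),
      v ∈ evalPart O cg (Nat.pair a (Nat.pair k i)) := by
  rw [evalPart_prec_succ, Part.mem_bind_iff]

theorem evalPart_rfind' : evalPart O (rfind' cf) (Nat.pair a m) =
    (Nat.rfind fun n => (evalPart O cf (Nat.pair a (n + m))).map fun x => decide (x = 0)).map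
      (· + m) := by
  simp only [evalPart, Nat.unpaired, Nat.unpair_pair]
  rfl

theorem mem_evalPart_rfind' : v ∈ evalPart O (rfind' cf) (Nat.pair a m) ↔
    ∃ k, v = k + m ∧ 0 ∈ evalPart O cf (Nat.pair a (k + m)) ∧
      ∀ i < k, ∃ y ≠ 0, y ∈ evalPart O cf (Nat.pair a (i + m)) := by
  rw [evalPart_rfind', Part.mem_map_iff]
  refine exists_congr fun k => ?_
  refine (and_congr Nat.mem_rfind eq_comm).trans (and_comm.trans ?_)
  refine and_congr Iff.rfl (and_congr ?_ (forall_congr' fun i => forall_congr' fun _ => ?_))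
  · refine (Part.mem_map_iff _).trans ?_
    simp
  · refine (Part.mem_map_iff _).trans ?_
    simp [and_comm]

end Membership

theorem evalPart_mono {O O' : ℕ →. ℕ} (h : ∀ n, ∀ v ∈ O n, v ∈ O' n) (c : OracleCode) :
    ∀ n, ∀ v ∈ evalPart O c n, v ∈ evalPart O' c n := by
  induction c with
  | zero | succ | left | right => exact fun n v hv => hv
  | oracle => exact h
  | pair cf cg hf hg =>
    intro n v hv
    rw [mem_evalPart_pair] at hv ⊢
    obtain ⟨x, hx, y, hy, rfl⟩ := hv
    exact ⟨x, hf _ _ hx, y, hg _ _ hy, rfl⟩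
  | comp cf cg hf hg =>
    intro n v hv
    rw [mem_evalPart_comp] at hv ⊢
    obtain ⟨x, hx, hv⟩ := hv
    exact ⟨x, hg _ _ hx, hf _ _ hv⟩
  | prec cf cg hf hg =>
    intro n
    obtain ⟨a, k, rfl⟩ : ∃ a k, n = Nat.pair a k := ⟨_, _, (Nat.pair_unpair n).symm⟩
    induction k with
    | zero =>
      intro v hv
      rw [evalPart_prec_zero] at hv ⊢
      exact hf _ _ hv
    | succ k ih =>
      intro v hv
      rw [mem_evalPart_prec_succ] at hv ⊢
      obtain ⟨x, hx, hv⟩ := hv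
      exact ⟨x, ih _ hx, hg _ _ hv⟩
  | rfind' cf hf =>
    intro n v hv
    obtain ⟨a, m, rfl⟩ : ∃ a k, n = Nat.pair a k := ⟨_, _, (Nat.pair_unpair n).symm⟩
    rw [mem_evalPart_rfind'] at hv ⊢
    obtain ⟨k, rfl, h0, hk⟩ := hv
    refine ⟨k, rfl, hf _ _ h0, fun i hi => ?_⟩
    obtain ⟨y, hy0, hy⟩ := hk i hi
    exact ⟨y, hy0, hf _ _ hy⟩

/-- Computations with the union of an increasing sequence of oracles use only one of them. -/
theorem exists_mem_evalPart {O : ℕ → ℕ →. ℕ} {O' : ℕ →. ℕ}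
    (hO : ∀ s t, s ≤ t → ∀ n, ∀ v ∈ O s n, v ∈ O t n) (h : ∀ n, ∀ v ∈ O' n, ∃ s, v ∈ O s n)
    (c : OracleCode) : ∀ n, ∀ v ∈ evalPart O' c n, ∃ s, v ∈ evalPart (O s) c n := by
  have mono (c : OracleCode) {s t : ℕ} (hst : s ≤ t) := evalPart_mono (hO s t hst) c
  induction c with
  | zero | succ | left | right => exact fun n v hv => ⟨0, hv⟩
  | oracle => exact h
  | pair cf cg hf hg =>
    intro n v hv
    simp only [mem_evalPart_pair] at hv ⊢
    obtain ⟨x, hx, y, hy, rfl⟩ := hv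
    obtain ⟨s, hs⟩ := hf _ _ hx
    obtain ⟨t, ht⟩ := hg _ _ hy
    exact ⟨max s t, x, mono _ (le_max_left _ _) _ _ hs, y, mono _ (le_max_right _ _) _ _ ht, rfl⟩
  | comp cf cg hf hg =>
    intro n v hv
    simp only [mem_evalPart_comp] at hv ⊢
    obtain ⟨x, hx, hv⟩ := hv
    obtain ⟨s, hs⟩ := hg _ _ hx
    obtain ⟨t, ht⟩ := hf _ _ hv
    exact ⟨max s t, x, mono _ (le_max_left _ _) _ _ hs, mono _ (le_max_right _ _) _ _ ht⟩
  | prec cf cg hf hg =>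
    intro n
    obtain ⟨a, k, rfl⟩ : ∃ a k, n = Nat.pair a k := ⟨_, _, (Nat.pair_unpair n).symm⟩
    induction k with
    | zero =>
      intro v hv
      simp only [evalPart_prec_zero] at hv ⊢
      exact hf _ _ hv
    | succ k ih =>
      intro v hv
      simp only [mem_evalPart_prec_succ] at hv ⊢
      obtain ⟨x, hx, hv⟩ := hv
      obtain ⟨s, hs⟩ := ih _ hx
      obtain ⟨t, ht⟩ := hg _ _ hv
      exact ⟨max s t, x, mono _ (le_max_left _ _) _ _ hs, mono _ (le_max_right _ _) _ _ ht⟩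
  | rfind' cf hf =>
    intro n v hv
    obtain ⟨a, m, rfl⟩ : ∃ a k, n = Nat.pair a k := ⟨_, _, (Nat.pair_unpair n).symm⟩
    simp only [mem_evalPart_rfind'] at hv ⊢
    obtain ⟨k, rfl, h0, hk⟩ := hv
    obtain ⟨s, hs⟩ := hf _ _ h0
    -- The search evaluates finitely many failing candidates, each settled by some oracle of the
    -- sequence; the maximum of their stages serves all of them.
    have : ∀ j ≤ k, ∃ t, ∀ i < j, ∃ y ≠ 0, y ∈ evalPart (O t) cf (Nat.pair a (i + m)) := by
      intro j
      induction j with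
      | zero => simp
      | succ j ih =>
        intro hj
        obtain ⟨t, ht⟩ := ih (by omega)
        obtain ⟨y, hy0, hy⟩ := hk j (by omega)
        obtain ⟨u, hu⟩ := hf _ _ hy
        refine ⟨max t u, fun i hi => ?_⟩
        obtain hi | rfl := Nat.lt_succ_iff_lt_or_eq.1 hi
        · obtain ⟨z, hz0, hz⟩ := ht i hi
          exact ⟨z, hz0, mono _ (le_max_left _ _) _ _ hz⟩
        · exact ⟨y, hy0, mono _ (le_max_right _ _) _ _ hu⟩
    obtain ⟨t, ht⟩ := this k le_rfl
    refine ⟨max s t, k, rfl, mono _ (le_max_left _ _) _ _ hs, fun i hi => ?_⟩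
    obtain ⟨y, hy0, hy⟩ := ht i hi
    exact ⟨y, hy0, mono _ (le_max_right _ _) _ _ hy⟩

/-! ### Simulating oracle programs by ordinary programs -/

open Nat.Partrec (Code)

/-- Translation into a program that takes a code of the oracle as an additional input; `q` is the
program for the oracle queries. -/
def trans (q : Code) : OracleCode → Code
  | zero => .zero
  | succ => .comp .succ .right
  | left => .comp .left .right
  | right => .comp .right .right
  | oracle => q
  | pair cf cg => .pair (trans q cf) (trans q cg)
  | comp cf cg => .comp (trans q cf) (.pair .left (trans q cg))
  | prec cf cg => .comp (.prec (trans q cf) (.comp (trans q cg)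
      (.pair (.comp .left .left) (.pair (.comp .right .left) .right))))
      (.pair (.pair .left (.comp .left .right)) (.comp .right .right))
  | rfind' cf => .comp (.rfind' (.comp (trans q cf)
      (.pair (.comp .left .left) (.pair (.comp .right .left) .right))))
      (.pair (.pair .left (.comp .left .right)) (.comp .right .right))

theorem eval_code_comp (cf cg : Code) (n : ℕ) :
    (Code.comp cf cg).eval n = (cg.eval n).bind fun x => cf.eval x := rfl

theorem eval_code_pair {cf cg : Code} {n x y : ℕ} (hf : cf.eval n = Part.some x)
    (hg : cg.eval n = Part.some y) : (Code.pair cf cg).eval n = Part.some (Nat.pair x y) := by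
  simp [Code.eval, hf, hg, Seq.seq]

theorem eval_code_comp_of_eq {cf cg : Code} {n x : ℕ} (hg : cg.eval n = Part.some x) :
    (Code.comp cf cg).eval n = cf.eval x := by
  rw [eval_code_comp, hg, Part.bind_some]

theorem eval_code_left (a b : ℕ) : Code.left.eval (Nat.pair a b) = Part.some a :=
  congrArg (fun p : ℕ × ℕ => Part.some p.1) (Nat.unpair_pair a b)

theorem eval_code_right (a b : ℕ) : Code.right.eval (Nat.pair a b) = Part.some b :=
  congrArg (fun p : ℕ × ℕ => Part.some p.2) (Nat.unpair_pair a b)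

/-- `prec` and `rfind'` read their input as parameter and counter, so `trans` moves the oracle code
into the parameter before such a recursion and back to the front inside it. This lemma and
`eval_code_assoc_left` verify the two rearrangements. -/
theorem eval_code_assoc_right (a b c : ℕ) :
    (Code.pair (.comp .left .left) (.pair (.comp .right .left) .right)).eval
      (Nat.pair (Nat.pair a b) c) = Part.some (Nat.pair a (Nat.pair b c)) :=
  eval_code_pair ((eval_code_comp_of_eq (eval_code_left _ _)).trans (eval_code_left _ _))
    (eval_code_pair ((eval_code_comp_of_eq (eval_code_left _ _)).trans (eval_code_right _ _))
      (eval_code_right _ _))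

theorem eval_code_assoc_left (a b c : ℕ) :
    (Code.pair (.pair .left (.comp .left .right)) (.comp .right .right)).eval
      (Nat.pair a (Nat.pair b c)) = Part.some (Nat.pair (Nat.pair a b) c) :=
  eval_code_pair (eval_code_pair (eval_code_left _ _)
    ((eval_code_comp_of_eq (eval_code_right _ _)).trans (eval_code_left _ _)))
    ((eval_code_comp_of_eq (eval_code_right _ _)).trans (eval_code_right _ _))

theorem eval_code_rfind' (cf : Code) (a m : ℕ) : (Code.rfind' cf).eval (Nat.pair a m) =
    (Nat.rfind fun n => (cf.eval (Nat.pair a (n + m))).map fun x => decide (x = 0)).map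
      (· + m) := by
  simp only [Code.eval, Nat.unpaired, Nat.unpair_pair]
  rfl

theorem eval_trans {q : Code} {s : ℕ} {O : ℕ →. ℕ} (hq : ∀ n, q.eval (Nat.pair s n) = O n)
    (c : OracleCode) : ∀ n, (trans q c).eval (Nat.pair s n) = evalPart O c n := by
  induction c with
  | zero => exact fun n => rfl
  | succ => exact fun n => eval_code_comp_of_eq (eval_code_right _ _)
  | left => exact fun n => eval_code_comp_of_eq (eval_code_right _ _)
  | right => exact fun n => eval_code_comp_of_eq (eval_code_right _ _)
  | oracle => exact hq
  | pair cf cg hf hg => intro n; simp [trans, evalPart, Code.eval, hf, hg]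
  | comp cf cg hf hg =>
    intro n
    have h : (Code.pair .left (trans q cg)).eval (Nat.pair s n) =
        (evalPart O cg n).map (Nat.pair s) := by
      rw [← hg]
      simp [Code.eval, Seq.seq]
    rw [trans, eval_code_comp, h, Part.bind_map]
    simp only [hf]
    rfl
  | prec cf cg hf hg =>
    intro n
    obtain ⟨a, k, rfl⟩ : ∃ a k, n = Nat.pair a k := ⟨_, _, (Nat.pair_unpair n).symm⟩
    rw [trans, eval_code_comp_of_eq (eval_code_assoc_left _ _ _)]
    induction k with
    | zero => rw [evalPart_prec_zero, Code.eval_prec_zero, hf]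
    | succ k ih =>
      rw [evalPart_prec_succ, Code.eval_prec_succ, ih]
      refine congrArg _ (funext fun i => ?_)
      rw [eval_code_comp_of_eq (eval_code_assoc_right _ _ _), hg]
  | rfind' cf hf =>
    intro n
    obtain ⟨a, m, rfl⟩ : ∃ a k, n = Nat.pair a k := ⟨_, _, (Nat.pair_unpair n).symm⟩
    rw [trans, eval_code_comp_of_eq (eval_code_assoc_left _ _ _), eval_code_rfind',
      evalPart_rfind']
    simp only [eval_code_comp_of_eq (eval_code_assoc_right _ _ _), hf]

/-- Course-of-values recursion on the index: the two lowest bits of `n - 5` select the constructor,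
and the remaining bits code smaller indices, whose translations are looked up in the list of earlier
values. -/
theorem primrec_trans (q : Code) : Primrec fun n => trans q (ofNat n) := by
  let assocL : Code := .pair (.pair .left (.comp .left .right)) (.comp .right .right)
  let assocR : Code := .pair (.comp .left .left) (.pair (.comp .right .left) .right)
  let compound (k : ℕ) (a b c : Code) : Code :=
    cond k.bodd
      (cond k.div2.bodd (.comp (.rfind' (.comp c assocR)) assocL)
        (.comp (.prec a (.comp b assocR)) assocL))
      (cond k.div2.bodd (.comp a (.pair .left b)) (.pair a b))
  have hcompound : Primrec fun p : ℕ × Code × Code × Code =>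
      compound p.1 p.2.1 p.2.2.1 p.2.2.2 := by
    have hk : Primrec fun p : ℕ × Code × Code × Code => p.1 := Primrec.fst
    have ha : Primrec fun p : ℕ × Code × Code × Code => p.2.1 := Primrec.fst.comp Primrec.snd
    have hb : Primrec fun p : ℕ × Code × Code × Code => p.2.2.1 :=
      Primrec.fst.comp (Primrec.snd.comp Primrec.snd)
    have hc : Primrec fun p : ℕ × Code × Code × Code => p.2.2.2 :=
      Primrec.snd.comp (Primrec.snd.comp Primrec.snd)
    have h2 := Primrec.nat_bodd.comp (Primrec.nat_div2.comp hk)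
    have hL : Primrec fun _ : ℕ × Code × Code × Code => assocL := Primrec.const _
    have hR : Primrec fun _ : ℕ × Code × Code × Code => assocR := Primrec.const _
    have hl : Primrec fun _ : ℕ × Code × Code × Code => Code.left := Primrec.const _
    exact Primrec.cond (Primrec.nat_bodd.comp hk)
      (Primrec.cond h2
        (Code.primrec₂_comp.comp (Code.primrec_rfind'.comp (Code.primrec₂_comp.comp hc hR)) hL)
        (Code.primrec₂_comp.comp (Code.primrec₂_prec.comp ha (Code.primrec₂_comp.comp hb hR)) hL))
      (Primrec.cond h2 (Code.primrec₂_comp.comp ha (Code.primrec₂_pair.comp hl hb))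
        (Code.primrec₂_pair.comp ha hb))
  let base : List Code := [.zero, .comp .succ .right, .comp .left .right, .comp .right .right, q]
  let half (l : List Code) : ℕ := (l.length - 5).div2.div2
  let step (l : List Code) : Option Code :=
    if l.length < 5 then base[l.length]? else
      l[(half l).unpair.1]?.bind fun a => l[(half l).unpair.2]?.bind fun b =>
        l[half l]?.map fun c => compound (l.length - 5) a b c
  have hhalf : Primrec half := Primrec.nat_div2.comp (Primrec.nat_div2.comp
    (Primrec.nat_sub.comp Primrec.list_length (Primrec.const 5)))
  have hstep : Primrec step := by
    refine Primrec.ite (Primrec.nat_lt.comp Primrec.list_length (Primrec.const 5))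
      (Primrec.list_getElem?.comp (Primrec.const base) Primrec.list_length) ?_
    refine Primrec.option_bind (Primrec.list_getElem?.comp Primrec.id
      (Primrec.fst.comp (Primrec.unpair.comp hhalf))) ?_
    refine Primrec.option_bind (Primrec.list_getElem?.comp Primrec.fst
      (Primrec.snd.comp (Primrec.unpair.comp (hhalf.comp Primrec.fst)))) ?_
    refine Primrec.option_map (Primrec.list_getElem?.comp (Primrec.fst.comp Primrec.fst)
      (hhalf.comp (Primrec.fst.comp Primrec.fst))) ?_
    exact hcompound.comp (Primrec.pair
      (Primrec.nat_sub.comp (Primrec.list_length.comp (Primrec.fst.comp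
        (Primrec.fst.comp Primrec.fst))) (Primrec.const 5))
      (Primrec.pair (Primrec.snd.comp (Primrec.fst.comp Primrec.fst))
        (Primrec.pair (Primrec.snd.comp Primrec.fst) Primrec.snd)))
  have key : Primrec₂ fun (_ : Unit) n => trans q (ofNat n) := by
    refine Primrec.nat_strong_rec _ (g := fun _ l => step l) (hstep.comp Primrec.snd) ?_
    rintro - n
    match n with
    | 0 | 1 | 2 | 3 | 4 => simp [step, base, ofNat, trans]
    | k + 5 =>
      have hm : k.div2.div2 < k + 5 := by
        simp only [Nat.div2_val]
        omega
      have h1 := k.div2.div2.unpair_left_le.trans_lt hm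
      have h2 := k.div2.div2.unpair_right_le.trans_lt hm
      simp only [step, half, List.length_map, List.length_range, Nat.add_sub_cancel,
        List.getElem?_map, List.getElem?_range hm, List.getElem?_range h1,
        List.getElem?_range h2, Option.map_some, Option.bind_some]
      rw [if_neg (by omega), ofNat]
      cases hb : k.bodd <;> cases hd : k.div2.bodd <;> simp [compound, trans, hb, hd, assocL, assocR]
  exact key.comp (Primrec.const ()) Primrec.id

end OracleCode

theorem List.take_map_range {α : Type*} (P : ℕ → α) (s t : ℕ) :
    ((List.range s).map P).take t = (List.range (min t s)).map P := by
  rw [← List.map_take, List.take_range]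

/-- The halting of the programs with an oracle is uniformly approximated by a primitive recursive
relation on finite initial segments of the oracle. -/
theorem exists_primrecRel_jump : ∃ H : ℕ → List ℕ → Prop, PrimrecRel H ∧
    (∀ e σ τ, σ <+: τ → H e σ → H e τ) ∧
    ∀ (W : ℕ → ℕ) (e : ℕ), turingJump W e = 1 ↔ ∃ s, H e ((List.range s).map W) := by
  let look (σ : List ℕ) : ℕ →. ℕ := fun n => Part.ofOption σ[n]?
  obtain ⟨q, hq⟩ : ∃ q : Nat.Partrec.Code, ∀ (σ : List ℕ) n,
      q.eval (Nat.pair (Encodable.encode σ) n) = look σ n := by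
    have h : Computable fun p : ℕ => (Denumerable.ofNat (List ℕ) p.unpair.1)[p.unpair.2]? :=
      (Primrec.list_getElem?.comp ((Primrec.ofNat _).comp (Primrec.fst.comp Primrec.unpair))
        (Primrec.snd.comp Primrec.unpair)).to_comp
    obtain ⟨q, hq⟩ := Nat.Partrec.Code.exists_code.1 (Partrec.nat_iff.1 h.ofOption)
    refine ⟨q, fun σ n => ?_⟩
    rw [hq]
    simp [look]
  have heval (σ : List ℕ) (e : ℕ) :=
    OracleCode.eval_trans (hq σ) (OracleCode.ofNat e) e
  have hlook (W : ℕ → ℕ) (s n v : ℕ) : v ∈ look ((List.range s).map W) n ↔ n < s ∧ v = W n := by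
    by_cases h : n < s <;> simp [look, h]
  -- The oracle is only the part `take t`, while the step bound is the full length: `evaln` rejects
  -- inputs above its bound, and the code of the whole string may outgrow its length. With `t` fixed
  -- and the bound growing, every halting computation is eventually seen.
  let R (t : ℕ) (p : ℕ × List ℕ) : Prop :=
    (Nat.Partrec.Code.evaln p.2.length (OracleCode.trans q (OracleCode.ofNat p.1))
      (Nat.pair (Encodable.encode (p.2.take t)) p.1)).isSome
  have hR : PrimrecRel R := by
    have h1 : Primrec fun p : ℕ × ℕ × List ℕ => p.2.1 := Primrec.fst.comp Primrec.snd
    have h2 : Primrec fun p : ℕ × ℕ × List ℕ => p.2.2 := Primrec.snd.comp Primrec.snd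
    refine Primrec.primrecPred ?_
    refine (Primrec.option_isSome.comp (Nat.Partrec.Code.primrec_evaln.comp (Primrec.pair
      (Primrec.pair (Primrec.list_length.comp h2) ((OracleCode.primrec_trans q).comp h1))
      (Primrec₂.natPair.comp (Primrec.encode.comp (Primrec.list_take.comp Primrec.fst h2))
        h1)))).of_eq fun p => ?_
    simp [R]
  refine ⟨fun e σ => ∃ t ∈ List.range (σ.length + 1), R t (e, σ), ?_, ?_, ?_⟩
  · exact PrimrecPred.comp (f := fun p : ℕ × List ℕ => (List.range (p.2.length + 1), p))
      hR.exists_mem_list ((Primrec.list_range.comp (Primrec.succ.comp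
        (Primrec.list_length.comp Primrec.snd))).pair Primrec.id)
  · rintro e σ τ ⟨ρ, rfl⟩ ⟨t, ht, h⟩
    rw [List.mem_range, Nat.lt_succ_iff] at ht
    refine ⟨t, List.mem_range.2 (by simp; omega), ?_⟩
    simp only [R, List.take_append_of_le_length ht] at h ⊢
    obtain ⟨v, hv⟩ := Option.isSome_iff_exists.1 h
    exact Option.isSome_iff_exists.2 ⟨v, Nat.Partrec.Code.evaln_mono (by simp) hv⟩
  · intro W e
    rw [turingJump_eq_one_iff, Part.dom_iff_mem, ← OracleCode.evalPart_coe]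
    constructor
    · rintro ⟨v, hv⟩
      obtain ⟨s, hs⟩ := OracleCode.exists_mem_evalPart
        (O := fun s => look ((List.range s).map W)) (O' := W)
        (fun s t hst n v hv => by
          rw [hlook] at hv ⊢
          exact ⟨hv.1.trans_le hst, hv.2⟩)
        (fun n v hv => ⟨n + 1, (hlook _ _ _ _).2 ⟨n.lt_succ_self, by simpa using hv⟩⟩) _ _ _ hv
      rw [← heval] at hs
      obtain ⟨k, hk⟩ := Nat.Partrec.Code.evaln_complete.1 hs
      -- `s` values of the oracle suffice for the computation and `k` bounds its steps.
      refine ⟨max s k, s, List.mem_range.2 (by simp), ?_⟩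
      simp only [R, List.take_map_range, min_eq_left (le_max_left s k), List.length_map,
        List.length_range]
      exact Option.isSome_iff_exists.2
        ⟨v, Nat.Partrec.Code.evaln_mono (le_max_right _ _) hk⟩
    · rintro ⟨s, t, -, h⟩
      obtain ⟨v, hv⟩ := Option.isSome_iff_exists.1 h
      have := Nat.Partrec.Code.evaln_sound hv
      simp only [List.take_map_range] at this
      rw [heval] at this
      refine ⟨v, OracleCode.evalPart_mono (fun n v hv => ?_) _ _ _ this⟩
      simpa using ((hlook _ _ _ _).1 hv).2

/-! ### Kleene-Brouwer orders -/

section KleeneBrouwer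

variable {α : Type} {r : α → α → Prop}

/-- The strict Kleene-Brouwer order on finite strings over an alphabet ordered by `r`: a string is
below its proper initial segments and below the strings that lie to the right of it. -/
def kbLt (r : α → α → Prop) : List α → List α → Prop
  | [], _ => False
  | _ :: _, [] => True
  | a :: σ, b :: τ => r a b ∨ (a = b ∧ kbLt r σ τ)

theorem kbLt_irrefl [Std.Irrefl r] (σ : List α) : ¬ kbLt r σ σ := by
  induction σ with
  | nil => exact id
  | cons a σ ih => simp [kbLt, ih, irrefl]

theorem kbLt_trans [IsTrans α r] {σ τ ρ : List α} (h : kbLt r σ τ) (h' : kbLt r τ ρ) :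
    kbLt r σ ρ := by
  induction σ generalizing τ ρ with
  | nil => exact h.elim
  | cons a σ ih =>
    cases τ with
    | nil => exact h'.elim
    | cons b τ =>
      cases ρ with
      | nil => trivial
      | cons c ρ =>
        rcases h with h | ⟨rfl, h⟩
        · rcases h' with h' | ⟨rfl, -⟩
          · exact Or.inl (_root_.trans h h')
          · exact Or.inl h
        · rcases h' with h' | ⟨rfl, h'⟩
          · exact Or.inl h'
          · exact Or.inr ⟨rfl, ih h h'⟩

theorem kbLt_trichotomy [Std.Trichotomous r] (σ τ : List α) :
    kbLt r σ τ ∨ σ = τ ∨ kbLt r τ σ := by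
  induction σ generalizing τ with
  | nil => cases τ <;> simp [kbLt]
  | cons a σ ih =>
    cases τ with
    | nil => simp [kbLt]
    | cons b τ =>
      rcases trichotomous_of r a b with h | rfl | h
      · exact Or.inl (Or.inl h)
      · rcases ih τ with h | rfl | h
        · exact Or.inl (Or.inr ⟨rfl, h⟩)
        · exact Or.inr (Or.inl rfl)
        · exact Or.inr (Or.inr (Or.inr ⟨rfl, h⟩))
      · exact Or.inr (Or.inr (Or.inl h))

theorem kbLt_append_left [Std.Irrefl r] (ρ : List α) {σ τ : List α} :
    kbLt r (ρ ++ σ) (ρ ++ τ) ↔ kbLt r σ τ := by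
  induction ρ with
  | nil => rfl
  | cons a ρ ih => simp [kbLt, ih, irrefl]

theorem kbLt_append_self [Std.Irrefl r] (σ : List α) {τ : List α} (h : τ ≠ []) :
    kbLt r (σ ++ τ) σ := by
  obtain ⟨a, τ, rfl⟩ := List.exists_cons_of_ne_nil h
  simpa [kbLt] using (kbLt_append_left (r := r) σ (σ := a :: τ) (τ := [])).2 trivial

theorem kbLt_append_cons [Std.Irrefl r] (ρ : List α) {a b : α} (σ τ : List α) (h : r a b) :
    kbLt r (ρ ++ a :: σ) (ρ ++ b :: τ) :=
  (kbLt_append_left ρ).2 (Or.inl h)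

/-- Two strings in the Kleene-Brouwer order either are in the relation of proper extension, or
branch at some position. -/
theorem kbLt_cases {σ τ : List α} (h : kbLt r σ τ) : (∃ a ρ, σ = τ ++ a :: ρ) ∨
    ∃ ρ a b σ' τ', r a b ∧ σ = ρ ++ a :: σ' ∧ τ = ρ ++ b :: τ' := by
  induction σ generalizing τ with
  | nil => exact h.elim
  | cons a σ ih =>
    cases τ with
    | nil => exact Or.inl ⟨a, σ, rfl⟩
    | cons b τ =>
      rcases h with h | ⟨rfl, h⟩
      · exact Or.inr ⟨[], a, b, σ, τ, h, rfl, rfl⟩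
      · rcases ih h with ⟨c, ρ, rfl⟩ | ⟨ρ, c, d, σ', τ', hcd, rfl, rfl⟩
        · exact Or.inl ⟨c, ρ, rfl⟩
        · exact Or.inr ⟨a :: ρ, c, d, σ', τ', hcd, rfl, rfl⟩

/-- A bounded search for the first difference, which makes the order primitive recursive. The
condition on `b` is vacuous when `τ` ends at `i`. -/
theorem kbLt_iff [Std.Irrefl r] {σ τ : List α} : kbLt r σ τ ↔ ∃ i < σ.length,
    σ.take i = τ.take i ∧ ∃ a ∈ σ[i]?, ∀ b ∈ τ[i]?, r a b := by
  constructor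
  · intro h
    rcases kbLt_cases h with ⟨a, ρ, rfl⟩ | ⟨ρ, a, b, σ', τ', hab, rfl, rfl⟩
    · exact ⟨τ.length, by simp, by simp, a, by simp, by simp⟩
    · exact ⟨ρ.length, by simp, by simp, a, by simp, by simpa using hab⟩
  · rintro ⟨i, hi, h, a, ha, hb⟩
    obtain ⟨_, rfl⟩ := List.getElem?_eq_some_iff.1 ha
    rw [← List.take_append_drop i σ, ← List.take_append_drop i τ, h, kbLt_append_left,
      List.drop_eq_getElem_cons hi]
    by_cases hj : i < τ.length
    · rw [List.drop_eq_getElem_cons hj]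
      exact Or.inl (hb _ (by simp [hj]))
    · rw [List.drop_eq_nil_of_le (as := τ) (by omega)]
      trivial

theorem primrecRel_kbLt [Primcodable α] [Std.Irrefl r] (hr : PrimrecRel r) :
    PrimrecRel (kbLt r) := by
  classical
  let R (i : ℕ) (p : List α × List α) : Prop :=
    p.1.take i = p.2.take i ∧ ∃ a ∈ p.1[i]?, ∀ b ∈ p.2[i]?, r a b
  have hR : PrimrecRel R := by
    have h1 : Primrec fun p : ℕ × List α × List α => p.2.1 := Primrec.fst.comp Primrec.snd
    have h2 : Primrec fun p : ℕ × List α × List α => p.2.2 := Primrec.snd.comp Primrec.snd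
    have h3 : Primrec fun p : ℕ × List α × List α =>
        (Option.casesOn p.2.1[p.1]? false fun a =>
          Option.casesOn p.2.2[p.1]? true fun b => decide (r a b) : Bool) := by
      refine Primrec.option_casesOn (Primrec.list_getElem?.comp h1 Primrec.fst)
        (Primrec.const false) ?_
      refine Primrec.option_casesOn (Primrec.list_getElem?.comp (h2.comp Primrec.fst)
        (Primrec.fst.comp Primrec.fst)) (Primrec.const true) ?_
      exact hr.decide.comp (Primrec.snd.comp Primrec.fst) Primrec.snd
    refine PrimrecPred.and (Primrec.eq.comp (Primrec.list_take.comp Primrec.fst h1)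
      (Primrec.list_take.comp Primrec.fst h2)) ?_
    refine (Primrec.eq.comp h3 (Primrec.const true)).of_eq fun p => ?_
    cases p.2.1[p.1]? <;> cases p.2.2[p.1]? <;> simp
  have h : PrimrecPred fun p : List α × List α =>
      ∃ i ∈ List.range p.1.length, R i p :=
    PrimrecPred.comp (f := fun p : List α × List α => (List.range p.1.length, p))
      hR.exists_mem_list ((Primrec.list_range.comp
        (Primrec.list_length.comp Primrec.fst)).pair Primrec.id)
  refine PrimrecPred.of_eq h fun p => ?_
  rw [kbLt_iff]
  simp [R]

/-- A sequence that descends in the Kleene-Brouwer order converges to an infinite path. -/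
theorem exists_take_eq_of_kbLt [IsWellFounded α r] (k : ℕ) {F : ℕ → List α}
    (hF : ∀ t, kbLt r (F (t + 1)) (F t)) :
    ∃ s, ∀ t, (F (s + t)).take k = (F s).take k ∧ k ≤ (F (s + t)).length := by
  induction k generalizing F with
  | zero => simp
  | succ k ih =>
    have hne (t : ℕ) : ∃ a σ, F (t + 1) = a :: σ := by
      have := hF t
      cases h : F (t + 1) with
      | nil => rw [h] at this; exact this.elim
      | cons a σ => exact ⟨a, σ, rfl⟩
    choose a σ haσ using hne
    have hstep (t : ℕ) : r (a (t + 1)) (a t) ∨ (a (t + 1) = a t ∧ kbLt r (σ (t + 1)) (σ t)) := by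
      have := hF (t + 1)
      rwa [haσ, haσ] at this
    -- First symbols never increase, so once the least one is attained they are constant, and from
    -- then on the tails descend.
    obtain ⟨_, ⟨s, rfl⟩, hmin⟩ := (IsWellFounded.wf (r := r)).has_min (Set.range a) ⟨_, 0, rfl⟩
    have hconst (t : ℕ) : a (s + t) = a s := by
      induction t with
      | zero => rfl
      | succ t iht =>
        rcases hstep (s + t) with h | h
        · exact absurd (iht ▸ h) (hmin _ ⟨s + t + 1, rfl⟩)
        · exact h.1.trans iht
    obtain ⟨u, hu⟩ := ih (F := fun t => σ (s + t)) fun t => by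
      rcases hstep (s + t) with h | h
      · exact absurd (hconst t ▸ h) (hmin _ ⟨s + t + 1, rfl⟩)
      · exact h.2
    refine ⟨s + u + 1, fun t => ?_⟩
    obtain ⟨h1, h2⟩ := hu t
    have e : s + u + 1 + t = s + (u + t) + 1 := by omega
    rw [e, haσ, haσ, hconst, hconst]
    simpa using ⟨h1, h2⟩

variable [Primcodable α]

open Encodable

/-- The Kleene-Brouwer order on a set of strings. -/
def kbOrder (r : α → α → Prop) [IsStrictTotalOrder α r] (T : Set (List α)) :
    CodedLinearOrder where
  carrier := {n | ∃ σ ∈ T, encode σ = n}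
  le m n := ∃ σ ∈ T, ∃ τ ∈ T, encode σ = m ∧ encode τ = n ∧ (σ = τ ∨ kbLt r σ τ)
  mem_of_le := by
    rintro _ _ ⟨σ, hσ, τ, hτ, rfl, rfl, -⟩
    exact ⟨⟨σ, hσ, rfl⟩, τ, hτ, rfl⟩
  le_refl := by
    rintro _ ⟨σ, hσ, rfl⟩
    exact ⟨σ, hσ, σ, hσ, rfl, rfl, Or.inl rfl⟩
  le_antisymm := by
    rintro _ _ ⟨σ, hσ, τ, hτ, rfl, rfl, h⟩ ⟨σ', -, τ', -, h1, h2, h'⟩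
    obtain rfl := encode_injective h1
    obtain rfl := encode_injective h2
    rcases h with rfl | h
    · rfl
    · rcases h' with rfl | h'
      · rfl
      · exact absurd (kbLt_trans h h') (kbLt_irrefl _)
  le_trans := by
    rintro _ _ _ ⟨σ, hσ, τ, hτ, rfl, rfl, h⟩ ⟨σ', -, τ', hτ', h1, rfl, h'⟩
    obtain rfl := encode_injective h1
    refine ⟨σ, hσ, τ', hτ', rfl, rfl, ?_⟩
    rcases h with rfl | h
    · exact h'
    · rcases h' with rfl | h'
      · exact Or.inr h
      · exact Or.inr (kbLt_trans h h')
  le_total := by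
    rintro _ ⟨σ, hσ, rfl⟩ _ ⟨τ, hτ, rfl⟩
    rcases kbLt_trichotomy (r := r) σ τ with h | rfl | h
    · exact Or.inl ⟨σ, hσ, τ, hτ, rfl, rfl, Or.inr h⟩
    · exact Or.inl ⟨σ, hσ, σ, hσ, rfl, rfl, Or.inl rfl⟩
    · exact Or.inr ⟨τ, hτ, σ, hσ, rfl, rfl, Or.inr h⟩

variable [IsStrictTotalOrder α r] {T : Set (List α)}

theorem kbOrder_lt {σ τ : List α} :
    (kbOrder r T).lt (encode σ) (encode τ) ↔ σ ∈ T ∧ τ ∈ T ∧ kbLt r σ τ := by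
  constructor
  · rintro ⟨⟨σ', hσ, τ', hτ, h1, h2, h⟩, hne⟩
    obtain rfl := encode_injective h1
    obtain rfl := encode_injective h2
    rcases h with rfl | h
    · exact absurd rfl hne
    · exact ⟨hσ, hτ, h⟩
  · rintro ⟨hσ, hτ, h⟩
    refine ⟨⟨σ, hσ, τ, hτ, rfl, rfl, Or.inr h⟩, fun e => ?_⟩
    obtain rfl := encode_injective e
    exact kbLt_irrefl _ h

theorem isComputableFrom_kbOrder {Z : ℕ → ℕ} (hr : PrimrecRel r)
    (hT : DecidableIn {(Z : ℕ →. ℕ)} fun σ => σ ∈ T) : (kbOrder r T).IsComputableFrom Z := by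
  -- Numbers that code no string decode to the default `[]`; the test `encode (d n) = n` in `hmem`
  -- excludes them.
  let d (n : ℕ) : List α := (decode n).getD []
  have hd : Primrec d := Primrec.option_getD.comp Primrec.decode (Primrec.const [])
  have hdec (σ : List α) : d (encode σ) = σ := by simp [d]
  have hmem (n : ℕ) : n ∈ (kbOrder r T).carrier ↔ encode (d n) = n ∧ d n ∈ T := by
    constructor
    · rintro ⟨σ, hσ, rfl⟩
      rw [hdec]
      exact ⟨rfl, hσ⟩
    · rintro ⟨h1, h2⟩
      exact ⟨_, h2, h1⟩
  have hcar : DecidableIn {(Z : ℕ →. ℕ)} fun n => n ∈ (kbOrder r T).carrier := by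
    refine DecidableIn.of_iff (DecidableIn.and ?_ (hT.comp hd.computableIn))
      fun n => (hmem n).symm
    exact (Primrec.eq.comp (Primrec.encode.comp hd) Primrec.id).decidableIn
  refine ⟨decidableIn_iff_charReal.1 hcar, decidableIn_iff_charReal.1 ?_⟩
  have h1 : Primrec fun p : ℕ => p.unpair.1 := Primrec.fst.comp Primrec.unpair
  have h2 : Primrec fun p : ℕ => p.unpair.2 := Primrec.snd.comp Primrec.unpair
  have hle : PrimrecPred fun p : ℕ => d p.unpair.1 = d p.unpair.2 ∨
      kbLt r (d p.unpair.1) (d p.unpair.2) :=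
    (Primrec.eq.comp (hd.comp h1) (hd.comp h2)).or
      ((primrecRel_kbLt hr).comp (hd.comp h1) (hd.comp h2))
  refine DecidableIn.of_iff (((hcar.comp h1.computableIn).and
    (hcar.comp h2.computableIn)).and hle.decidableIn) fun p => ?_
  rw [hmem, hmem, Set.mem_ofPred_eq]
  constructor
  · rintro ⟨⟨⟨e1, m1⟩, e2, m2⟩, h⟩
    exact ⟨_, m1, _, m2, e1, e2, h⟩
  · rintro ⟨σ, hσ, τ, hτ, e1, e2, h⟩
    rw [← e1, ← e2, hdec, hdec]
    exact ⟨⟨⟨rfl, hσ⟩, rfl, hτ⟩, h⟩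

/-- The jump of a descending sequence in the Kleene-Brouwer order of a tree computes a path. -/
theorem exists_path_of_isDescending [IsWellFounded α r]
    (hT : ∀ σ τ, σ <+: τ → τ ∈ T → σ ∈ T) {f : ℕ → ℕ} (hf : (kbOrder r T).IsDescending f) :
    ∃ P : ℕ → α, ComputableIn {(turingJump f : ℕ →. ℕ)} P ∧
      ∀ k, (List.range k).map P ∈ T := by
  classical
  let F (t : ℕ) : List α := (decode (f t)).getD []
  have hFf (t : ℕ) : encode (F t) = f t ∧ F t ∈ T := by
    obtain ⟨σ, hσ, h⟩ := hf.1 t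
    simp only [F, ← h, encodek, Option.getD_some]
    exact ⟨trivial, hσ⟩
  have hFlt (t : ℕ) : kbLt r (F (t + 1)) (F t) := by
    have := hf.2 t
    rw [← (hFf t).1, ← (hFf (t + 1)).1, kbOrder_lt] at this
    exact this.2.2
  have hF : ComputableIn {(f : ℕ →. ℕ)} F :=
    (Primrec.option_getD.comp Primrec.decode (Primrec.const [])).computableIn.comp
      (computableIn_self f)
  -- A later stage violating stability of the prefix of length `k + 1` is an existential event over
  -- `f`. Hence `f'` recognises the stages without violation, and `S k` is found by search.
  have hR : DecidableIn {(f : ℕ →. ℕ)} fun q : (ℕ × ℕ) × ℕ =>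
      ¬ ((F (q.1.2 + q.2)).take (q.1.1 + 1) = (F q.1.2).take (q.1.1 + 1) ∧
        q.1.1 + 1 ≤ (F (q.1.2 + q.2)).length) := by
    have hF1 : ComputableIn {(f : ℕ →. ℕ)} fun q : (ℕ × ℕ) × ℕ => F (q.1.2 + q.2) :=
      hF.comp (Primrec.nat_add.comp (Primrec.snd.comp Primrec.fst) Primrec.snd).computableIn
    have hF2 : ComputableIn {(f : ℕ →. ℕ)} fun q : (ℕ × ℕ) × ℕ => F q.1.2 :=
      hF.comp (Primrec.snd.comp Primrec.fst).computableIn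
    have hk : ComputableIn {(f : ℕ →. ℕ)} fun q : (ℕ × ℕ) × ℕ => q.1.1 + 1 :=
      (Primrec.succ.comp (Primrec.fst.comp Primrec.fst)).computableIn
    have hp : PrimrecPred fun p : ℕ × List α × List α =>
        p.2.1.take p.1 = p.2.2.take p.1 ∧ p.1 ≤ p.2.1.length :=
      (Primrec.eq.comp (Primrec.list_take.comp Primrec.fst (Primrec.fst.comp Primrec.snd))
        (Primrec.list_take.comp Primrec.fst (Primrec.snd.comp Primrec.snd))).and
      (Primrec.nat_le.comp Primrec.fst (Primrec.list_length.comp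
        (Primrec.fst.comp Primrec.snd)))
    exact (hp.decidableIn.comp (hk.pair (hF1.pair hF2))).not
  obtain ⟨S, hS, hSF⟩ := (DecidableIn.exists_jump
    (R := fun (p : ℕ × ℕ) t => ¬ ((F (p.2 + t)).take (p.1 + 1) = (F p.2).take (p.1 + 1) ∧
        p.1 + 1 ≤ (F (p.2 + t)).length)) hR).not.exists_choice
    (R := fun k s => ¬ ∃ t, ¬ ((F (s + t)).take (k + 1) = (F s).take (k + 1) ∧
        k + 1 ≤ (F (s + t)).length)) fun k => by
      obtain ⟨s, hs⟩ := exists_take_eq_of_kbLt (k + 1) hFlt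
      exact ⟨s, fun ⟨t, ht⟩ => ht (hs t)⟩
  simp only [not_exists, not_not] at hSF
  have hlen (k : ℕ) : k < (F (S k)).length := (hSF k 0).2
  let P (k : ℕ) : α := (F (S k))[k]'(hlen k)
  have hP : ComputableIn {(turingJump f : ℕ →. ℕ)} P := by
    have hFj : ComputableIn {(turingJump f : ℕ →. ℕ)} F := hF.trans (computableFrom_turingJump f)
    refine ((Primrec.list_getD (P 0)).computableIn.comp
      ((hFj.comp hS).pair ComputableIn.id)).of_eq fun k => ?_
    exact List.getD_eq_getElem _ _ (hlen k)
  refine ⟨P, hP, fun k => ?_⟩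
  -- The stages `S k` need not increase with `k`, so a common stage is obtained from maxima.
  have hlim : ∃ s, ∀ t ≥ s, (F t).take k = (List.range k).map P := by
    induction k with
    | zero => simp
    | succ k ih =>
      obtain ⟨s, hs⟩ := ih
      refine ⟨max s (S k), fun t ht => ?_⟩
      obtain ⟨u, rfl⟩ := Nat.exists_eq_add_of_le (le_of_max_le_right ht)
      obtain ⟨h1, h2⟩ := hSF k u
      rw [List.take_succ_eq_append_getElem h2, hs _ (le_of_max_le_left ht), List.range_succ,
        List.map_append, List.map_singleton]
      have : (F (S k + u))[k]? = (F (S k))[k]? := by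
        have := congrArg (fun l : List α => l[k]?) h1
        simpa [List.getElem?_take] using this
      rw [List.getElem?_eq_getElem h2, List.getElem?_eq_getElem (hlen k)] at this
      rw [Option.some.inj this]
  obtain ⟨s, hs⟩ := hlim
  rw [← hs s le_rfl]
  exact hT _ _ (List.take_prefix _ _) (hFf s).2

end KleeneBrouwer

/-! ### The jump tree -/

section JumpTree

variable {α : Type} [Primcodable α]

open Encodable

/-- Replace the first symbol `inr x` of `E` whose index `i` satisfies `H i σ` by `inl σ` and drop
what follows it. -/
def repair (H : ℕ → List α → Bool) (σ : List α) (E : List (ℕ ⊕ α)) : List (ℕ ⊕ α) :=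
  let i := (List.range E.length).findIdx fun i =>
    (E[i]?.elim false Sum.isRight) && H i σ
  if i < E.length then E.take i ++ [Sum.inl (encode σ)] else E

theorem repair_cases (H : ℕ → List α → Bool) (σ : List α) (E : List (ℕ ⊕ α)) :
    (repair H σ E = E ∧ ∀ i y, E[i]? = some (Sum.inr y) → H i σ = false) ∨
    ∃ i y, E[i]? = some (Sum.inr y) ∧ H i σ = true ∧
      (∀ j < i, ∀ z, E[j]? = some (Sum.inr z) → H j σ = false) ∧
      repair H σ E = E.take i ++ [Sum.inl (encode σ)] := by
  set p : ℕ → Bool := fun i => (E[i]?.elim false Sum.isRight) && H i σ with hp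
  have hnot : ∀ j < (List.range E.length).findIdx p, ∀ z, E[j]? = some (Sum.inr z) →
      H j σ = false := by
    intro j hj z hz
    have := List.not_of_lt_findIdx hj
    simpa [hp, hz] using this
  by_cases hi : (List.range E.length).findIdx p < E.length
  · right
    have hpi := List.findIdx_getElem (xs := List.range E.length) (p := p) (w := by simpa using hi)
    rw [List.getElem_range] at hpi
    have hE := List.getElem?_eq_getElem hi
    simp only [hp, Bool.and_eq_true] at hpi
    rw [← hp, hE] at hpi
    obtain ⟨y, hy⟩ := Sum.isRight_iff.1 hpi.1
    exact ⟨_, y, hE.trans (congrArg some hy), hpi.2, hnot, if_pos hi⟩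
  · left
    refine ⟨if_neg hi, fun i y hy => hnot i ?_ y hy⟩
    have := (List.getElem?_eq_some_iff.1 hy).1
    omega

theorem primrec₂_repair {H : ℕ → List α → Bool} (hH : Primrec₂ H) : Primrec₂ (repair H) := by
  have hi : Primrec₂ fun (p : List α × List (ℕ ⊕ α)) (i : ℕ) =>
      ((p.2[i]?.elim false Sum.isRight) && H i p.1 : Bool) := by
    have h1 : Primrec fun q : (List α × List (ℕ ⊕ α)) × ℕ =>
        (Option.casesOn q.1.2[q.2]? false fun s =>
          (Sum.casesOn s (fun _ => false) fun _ => true) : Bool) := by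
      refine Primrec.option_casesOn (Primrec.list_getElem?.comp
        (Primrec.snd.comp Primrec.fst) Primrec.snd) (Primrec.const false) ?_
      exact Primrec.sumCasesOn Primrec.snd (Primrec.const false).to₂ (Primrec.const true).to₂
    refine (Primrec.and.comp h1 (hH.comp Primrec.snd (Primrec.fst.comp Primrec.fst))).of_eq
      fun q => ?_
    congr 1
    rcases q.1.2[q.2]? with _ | (_ | _) <;> rfl
  have hidx := Primrec.list_findIdx (Primrec.list_range.comp
    (Primrec.list_length.comp (Primrec.snd (α := List α) (β := List (ℕ ⊕ α))))) hi
  refine Primrec.ite (Primrec.nat_lt.comp hidx (Primrec.list_length.comp Primrec.snd))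
    (Primrec.list_concat.comp (Primrec.list_take.comp hidx Primrec.snd)
      (Primrec.sumInl.comp (Primrec.encode.comp Primrec.fst))) Primrec.snd

variable (H : ℕ → List α → Bool)

/-- The state after reading a string: the string, the provisional and the final approximation to
its jump, and the codes of all approximations met so far. -/
def jumpState (σ : List α) : List α × List (ℕ ⊕ α) × List (ℕ ⊕ α) × List ℕ :=
  σ.foldl (fun s x =>
    (s.1 ++ [x], s.2.2.1 ++ [Sum.inr x], repair H (s.1 ++ [x]) (s.2.2.1 ++ [Sum.inr x]),
      s.2.2.2 ++ [encode (s.2.2.1 ++ [Sum.inr x]),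
        encode (repair H (s.1 ++ [x]) (s.2.2.1 ++ [Sum.inr x]))])) ([], [], [], [])

/-- The approximation to the jump of a string. The symbol with index `i` is `inr x` if `H i` does
not hold yet, and `inl τ` if it was first noticed at the initial segment `τ` that it does. -/
def jumpString (σ : List α) : List (ℕ ⊕ α) := (jumpState H σ).2.2.1

/-- The approximation to the jump of a string before the last symbol is examined. -/
def preJumpString (σ : List α) : List (ℕ ⊕ α) := (jumpState H σ).2.1

/-- The codes of the approximations to the jumps of the nonempty initial segments. -/
def jumpChain (σ : List α) : List ℕ := (jumpState H σ).2.2.2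

theorem jumpState_fst (σ : List α) : (jumpState H σ).1 = σ := by
  induction σ using List.reverseRecOn with
  | nil => rfl
  | append_singleton σ x ih => simpa [jumpState] using ih

theorem preJumpString_concat (σ : List α) (x : α) :
    preJumpString H (σ ++ [x]) = jumpString H σ ++ [Sum.inr x] := by
  simp [preJumpString, jumpString, jumpState]

theorem jumpString_concat (σ : List α) (x : α) : jumpString H (σ ++ [x]) =
    repair H (σ ++ [x]) (jumpString H σ ++ [Sum.inr x]) := by
  have := jumpState_fst H σ
  rw [jumpString, jumpState, List.foldl_append, List.foldl_cons, List.foldl_nil]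
  change repair H ((jumpState H σ).1 ++ [x]) _ = _
  rw [this]
  rfl

theorem jumpChain_concat (σ : List α) (x : α) : jumpChain H (σ ++ [x]) =
    jumpChain H σ ++ [encode (preJumpString H (σ ++ [x])), encode (jumpString H (σ ++ [x]))] := by
  rw [preJumpString, jumpString, jumpChain, jumpState, List.foldl_append, List.foldl_cons,
    List.foldl_nil]
  rfl

theorem primrec_jumpState (hH : Primrec₂ H) : Primrec (jumpState H) := by
  let S := List α × List (ℕ ⊕ α) × List (ℕ ⊕ α) × List ℕ
  have hs : Primrec fun q : List α × S × α => q.2.1 := Primrec.fst.comp Primrec.snd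
  have hx : Primrec fun q : List α × S × α => q.2.2 := Primrec.snd.comp Primrec.snd
  have h1 := Primrec.list_concat.comp (Primrec.fst.comp hs) hx
  have h2 := Primrec.list_concat.comp (Primrec.fst.comp (Primrec.snd.comp (Primrec.snd.comp hs)))
    (Primrec.sumInr.comp hx)
  have h3 := (primrec₂_repair hH).comp h1 h2
  have h4 := Primrec.list_append.comp (Primrec.snd.comp (Primrec.snd.comp (Primrec.snd.comp hs)))
    (Primrec.list_cons.comp (Primrec.encode.comp h2)
      (Primrec.list_cons.comp (Primrec.encode.comp h3) (Primrec.const [])))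
  exact Primrec.list_foldl Primrec.id (Primrec.const _) (h1.pair (h2.pair (h3.pair h4))).to₂

/-- Recover a string from the approximation to its jump. -/
def unjump (τ : List (ℕ ⊕ α)) : List α :=
  τ.foldl (fun σ s => Sum.casesOn s (fun ν => (decode ν).getD []) fun x => σ ++ [x]) []

theorem primrec_unjump : Primrec (unjump (α := α)) := by
  refine Primrec.list_foldl Primrec.id (Primrec.const [])
    (h := fun _ (p : List α × (ℕ ⊕ α)) =>
      Sum.casesOn p.2 (fun ν => (decode ν).getD []) fun x => p.1 ++ [x]) ?_
  refine Primrec.sumCasesOn (Primrec.snd.comp Primrec.snd) ?_ ?_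
  · exact Primrec.option_getD.comp (Primrec.decode.comp Primrec.snd) (Primrec.const [])
  · exact Primrec.list_concat.comp (Primrec.fst.comp (Primrec.snd.comp Primrec.fst)) Primrec.snd

theorem unjump_concat_inr (τ : List (ℕ ⊕ α)) (x : α) :
    unjump (τ ++ [Sum.inr x]) = unjump τ ++ [x] := by
  simp [unjump]

theorem unjump_concat_inl (τ : List (ℕ ⊕ α)) (σ : List α) :
    unjump (τ ++ [Sum.inl (encode σ)]) = σ := by
  simp [unjump]

theorem jumpString_concat_cases (σ : List α) (x : α) :
    jumpString H (σ ++ [x]) = jumpString H σ ++ [Sum.inr x] ∨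
    ∃ E y, E <+: jumpString H σ ∧ E ++ [Sum.inr y] <+: jumpString H σ ++ [Sum.inr x] ∧
      H E.length (σ ++ [x]) = true ∧
      jumpString H (σ ++ [x]) = E ++ [Sum.inl (encode (σ ++ [x]))] := by
  rw [jumpString_concat]
  rcases repair_cases H (σ ++ [x]) (jumpString H σ ++ [Sum.inr x]) with h | ⟨i, y, h1, h2, -, h4⟩
  · exact Or.inl h.1
  · obtain ⟨hi, hy⟩ := List.getElem?_eq_some_iff.1 h1
    have hi' : i ≤ (jumpString H σ).length := by
      rw [List.length_append, List.length_singleton] at hi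
      omega
    refine Or.inr ⟨_, y, ?_, ?_, ?_, h4⟩
    · rw [List.take_append_of_le_length hi']
      exact List.take_prefix _ _
    · rw [← hy, ← List.take_succ_eq_append_getElem hi]
      exact List.take_prefix _ _
    · rwa [List.length_take, min_eq_left hi.le]

/-- A repair erases part of the approximation, but its `inl` symbol codes the whole string read so
far, so nothing is lost. -/
theorem unjump_jumpString (σ : List α) : unjump (jumpString H σ) = σ := by
  induction σ using List.reverseRecOn with
  | nil => rfl
  | append_singleton σ x ih =>
    rcases jumpString_concat_cases H σ x with h | ⟨E, y, -, -, -, h⟩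
    · rw [h, unjump_concat_inr, ih]
    · rw [h, unjump_concat_inl]

theorem unjump_preJumpString (σ : List α) : unjump (preJumpString H σ) = σ := by
  rcases List.eq_nil_or_concat σ with rfl | ⟨σ, x, rfl⟩
  · rfl
  · rw [List.concat_eq_append, preJumpString_concat, unjump_concat_inr, unjump_jumpString]

/-- A repair cuts back to a prefix of the previous approximation before adding its last symbol, so
by induction proper prefixes are themselves earlier approximations. -/
theorem exists_eq_jumpString_of_prefix {τ : List (ℕ ⊕ α)} {σ : List α}
    (h : τ <+: jumpString H σ) : ∃ ρ, ρ <+: σ ∧ τ = jumpString H ρ := by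
  induction σ using List.reverseRecOn with
  | nil => exact ⟨[], List.prefix_rfl, List.prefix_nil.1 h⟩
  | append_singleton σ x ih =>
    have hσ : σ <+: σ ++ [x] := List.prefix_append _ _
    rcases jumpString_concat_cases H σ x with h' | ⟨E, y, hE, -, -, h'⟩
    · rcases List.prefix_concat_iff.1 (h' ▸ h) with e | e
      · exact ⟨_, List.prefix_rfl, e.trans h'.symm⟩
      · obtain ⟨ρ, hρ, e⟩ := ih e
        exact ⟨ρ, hρ.trans hσ, e⟩
    · rcases List.prefix_concat_iff.1 (h' ▸ h) with e | e
      · exact ⟨_, List.prefix_rfl, e.trans h'.symm⟩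
      · obtain ⟨ρ, hρ, e⟩ := ih (e.trans hE)
        exact ⟨ρ, hρ.trans hσ, e⟩

theorem exists_eq_jumpString_of_prefix_preJumpString {τ : List (ℕ ⊕ α)} {σ : List α}
    (h : τ <+: preJumpString H σ) (hne : τ ≠ preJumpString H σ) :
    ∃ ρ, ρ <+: σ ∧ τ = jumpString H ρ := by
  rcases List.eq_nil_or_concat σ with rfl | ⟨σ, x, rfl⟩
  · exact absurd (List.prefix_nil.1 h) hne
  · rw [List.concat_eq_append, preJumpString_concat] at h hne
    obtain ⟨ρ, hρ, e⟩ :=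
      exists_eq_jumpString_of_prefix H ((List.prefix_concat_iff.1 h).resolve_left hne)
    exact ⟨ρ, hρ.trans (by simp), e⟩

/-- Although each step repairs only one position, it is the first outdated one and everything after
it is dropped, so every surviving `inr` is up to date. -/
theorem eq_false_of_jumpString_getElem? {σ : List α} {i : ℕ} {y : α}
    (h : (jumpString H σ)[i]? = some (Sum.inr y)) : H i σ = false := by
  rcases List.eq_nil_or_concat σ with rfl | ⟨σ, x, rfl⟩
  · simp [jumpString, jumpState] at h
  · rw [List.concat_eq_append] at h ⊢
    rw [jumpString_concat] at h
    rcases repair_cases H (σ ++ [x]) (jumpString H σ ++ [Sum.inr x]) with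
      ⟨h1, h2⟩ | ⟨j, z, h1, -, h3, h4⟩
    · exact h2 i y (h1 ▸ h)
    · have hj := (List.getElem?_eq_some_iff.1 h1).1
      rw [h4] at h
      by_cases hij : i < j
      · rw [List.getElem?_append_left (by rw [List.length_take]; omega),
          List.getElem?_take_of_lt hij] at h
        exact h3 i hij y h
      · rw [List.getElem?_append_right (by rw [List.length_take]; omega)] at h
        rw [List.getElem?_singleton] at h
        split_ifs at h
        cases h

theorem exists_of_jumpString_getElem? {σ : List α} {i ν : ℕ}
    (h : (jumpString H σ)[i]? = some (Sum.inl ν)) : ∃ ρ, ρ <+: σ ∧ H i ρ = true := by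
  induction σ using List.reverseRecOn with
  | nil => simp [jumpString, jumpState] at h
  | append_singleton σ x ih =>
    have hσ : σ <+: σ ++ [x] := List.prefix_append _ _
    have key (hi : (jumpString H σ)[i]? = some (Sum.inl ν)) :
        ∃ ρ, ρ <+: σ ++ [x] ∧ H i ρ = true := by
      obtain ⟨ρ, hρ, e⟩ := ih hi
      exact ⟨ρ, hρ.trans hσ, e⟩
    rcases jumpString_concat_cases H σ x with h' | ⟨E, y, ⟨E', hE⟩, -, hH, h'⟩
    · rw [h', List.getElem?_append] at h
      split_ifs at h with hi
      · exact key h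
      · rw [List.getElem?_singleton] at h
        split_ifs at h
        cases h
    · rw [h', List.getElem?_append] at h
      split_ifs at h with hi
      · refine key ?_
        rw [← hE, List.getElem?_append_left hi, h]
      · rw [List.getElem?_singleton] at h
        split_ifs at h with h0
        have : i = E.length := by omega
        exact ⟨_, List.prefix_rfl, this ▸ hH⟩

/-- The tree of the approximations to the jumps of the strings in `T`. -/
def jumpTree (T : Set (List α)) : Set (List (ℕ ⊕ α)) :=
  {τ | unjump τ ∈ T ∧ (jumpString H (unjump τ) = τ ∨ preJumpString H (unjump τ) = τ)}

variable {H} {T : Set (List α)}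

theorem jumpString_mem {σ : List α} (hσ : σ ∈ T) : jumpString H σ ∈ jumpTree H T := by
  show _ ∧ _
  rw [unjump_jumpString]
  exact ⟨hσ, Or.inl rfl⟩

theorem preJumpString_mem {σ : List α} (hσ : σ ∈ T) : preJumpString H σ ∈ jumpTree H T := by
  show _ ∧ _
  rw [unjump_preJumpString]
  exact ⟨hσ, Or.inr rfl⟩

/-- Approximations that still await a repair are therefore leaves, and paths run only through values
of `jumpString`. -/
theorem exists_eq_jumpString_of_mem {ρ τ : List (ℕ ⊕ α)} (hT : ∀ σ τ, σ <+: τ → τ ∈ T → σ ∈ T)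
    (hτ : τ ∈ jumpTree H T) (h : ρ <+: τ) (hne : ρ ≠ τ) : ∃ σ ∈ T, ρ = jumpString H σ := by
  obtain ⟨h1, h2 | h2⟩ := hτ
  · obtain ⟨σ, hσ, e⟩ := exists_eq_jumpString_of_prefix H (h2.symm ▸ h)
    exact ⟨σ, hT _ _ hσ h1, e⟩
  · obtain ⟨σ, hσ, e⟩ := exists_eq_jumpString_of_prefix_preJumpString H (h2.symm ▸ h)
      (h2.symm ▸ hne)
    exact ⟨σ, hT _ _ hσ h1, e⟩

theorem jumpTree_prefix (hT : ∀ σ τ, σ <+: τ → τ ∈ T → σ ∈ T) (ρ τ : List (ℕ ⊕ α))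
    (h : ρ <+: τ) (hτ : τ ∈ jumpTree H T) : ρ ∈ jumpTree H T := by
  by_cases hne : ρ = τ
  · exact hne ▸ hτ
  · obtain ⟨σ, hσ, rfl⟩ := exists_eq_jumpString_of_mem hT hτ h hne
    exact jumpString_mem hσ

theorem decidableIn_jumpTree {O : Set (ℕ →. ℕ)} (hH : Primrec₂ H)
    (hT : DecidableIn O fun σ => σ ∈ T) : DecidableIn O fun τ => τ ∈ jumpTree H T := by
  have h := (primrec_jumpState H hH).comp (primrec_unjump (α := α))
  exact (hT.comp primrec_unjump.computableIn).and (PrimrecPred.decidableIn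
    ((Primrec.eq.comp (Primrec.fst.comp (Primrec.snd.comp (Primrec.snd.comp h))) Primrec.id).or
      (Primrec.eq.comp (Primrec.fst.comp (Primrec.snd.comp h)) Primrec.id)))

/-- A path through the jump tree computes a path through the tree together with the truth values
of `H` along it. -/
theorem exists_path_of_jumpTree (hT : ∀ σ τ, σ <+: τ → τ ∈ T → σ ∈ T)
    (hH : ∀ j σ τ, σ <+: τ → H j σ = true → H j τ = true) {O : Set (ℕ →. ℕ)}
    {Q : ℕ → ℕ ⊕ α} (hQ : ComputableIn O Q) (hQT : ∀ k, (List.range k).map Q ∈ jumpTree H T) :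
    ∃ P : ℕ → α, ComputableIn O P ∧ (∀ k, (List.range k).map P ∈ T) ∧
      ∀ j, (∃ s, H j ((List.range s).map P) = true) ↔ (Q j).isLeft = true := by
  let q (k : ℕ) : List (ℕ ⊕ α) := (List.range k).map Q
  have hq_succ (k : ℕ) : q (k + 1) = q k ++ [Q k] := by simp [q, List.range_succ]
  have hqlen (k : ℕ) : (q k).length = k := by simp [q]
  have hqpre (k : ℕ) : q k <+: q (k + 1) := by
    rw [hq_succ]
    exact List.prefix_append _ _
  have hq : ComputableIn O q := computableIn_map_range hQ
  let s (k : ℕ) : List α := unjump (q k)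
  have hs (k : ℕ) : s k ∈ T ∧ q k = jumpString H (s k) := by
    obtain ⟨σ, hσ, e⟩ := exists_eq_jumpString_of_mem hT (hQT (k + 1)) (ρ := q k)
      (hqpre k) fun e => by
        have := congrArg List.length e
        simp [q] at this
    have : s k = σ := by rw [← unjump_jumpString H σ, ← e]
    exact this ▸ ⟨hσ, e⟩
  have hs_succ (k : ℕ) : s k <+: s (k + 1) := by
    obtain ⟨ρ, hρ, e⟩ := exists_eq_jumpString_of_prefix H (τ := q k) (σ := s (k + 1))
      ((hs (k + 1)).2 ▸ hqpre k)
    have : s k = ρ := by rw [← unjump_jumpString H ρ, ← e]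
    exact this ▸ hρ
  have hs_mono {k l : ℕ} (h : k ≤ l) : s k <+: s l := by
    induction l, h using Nat.le_induction with
    | base => exact List.prefix_rfl
    | succ l _ ih => exact ih.trans (hs_succ l)
  have hlen (k : ℕ) : k ≤ (s k).length := by
    induction k with
    | zero => exact Nat.zero_le _
    | succ k ih =>
      -- If `s k` and `s (k + 1)` had equal length they would coincide, and so would `q k` and `q (k
      -- + 1)`.
      refine Nat.succ_le_of_lt (ih.trans_lt (lt_of_le_of_ne (hs_succ k).length_le fun e => ?_))
      have h1 := (hs_succ k).eq_of_length e
      have h2 := congrArg List.length ((hs k).2.trans (h1 ▸ (hs (k + 1)).2.symm))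
      rw [hqlen, hqlen] at h2
      omega
  let P (m : ℕ) : α := (s (m + 1))[m]'(hlen (m + 1))
  have hP : ComputableIn O P := by
    refine ((Primrec.list_getD (P 0)).computableIn.comp ((primrec_unjump.computableIn.comp
      (hq.comp ComputableIn.succ)).pair ComputableIn.id)).of_eq fun k => ?_
    exact List.getD_eq_getElem _ _ (hlen (k + 1))
  have htake (m : ℕ) : ∀ k ≥ m, (s k).take m = (List.range m).map P := by
    induction m with
    | zero => simp
    | succ m ih =>
      intro k hk
      have hmk : m < (s k).length := hk.trans (hlen k)
      rw [List.take_succ_eq_append_getElem hmk, ih k (by omega), List.range_succ,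
        List.map_append, List.map_singleton]
      congr 2
      exact ((hs_mono hk).getElem _).symm
  have hseg (k : ℕ) : s k = (List.range (s k).length).map P := by
    rw [← htake _ _ le_rfl]
    exact List.prefix_iff_eq_take.1 (hs_mono (hlen k))
  have hpre {m k : ℕ} (h : m ≤ k) : (List.range m).map P <+: s k :=
    htake m k h ▸ List.take_prefix _ _
  refine ⟨P, hP, fun k => hT _ _ (hpre le_rfl) (hs k).1, fun j => ⟨?_, fun h => ?_⟩⟩
  · rintro ⟨m, hm⟩
    -- The stage is late enough both to extend the segment where `H j` holds and to have a symbol at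
    -- position `j`.
    have hk := hH j _ _ (hpre (le_max_left m (j + 1))) hm
    have hj : (jumpString H (s (max m (j + 1))))[j]? = some (Q j) := by
      rw [← (hs _).2]
      simp [q]
    cases hQj : Q j with
    | inl ν => rfl
    | inr y =>
      rw [hQj] at hj
      rw [eq_false_of_jumpString_getElem? H hj] at hk
      cases hk
  · obtain ⟨ν, hν⟩ := Sum.isLeft_iff.1 h
    have hj : (jumpString H (s (j + 1)))[j]? = some (Sum.inl ν) := by
      rw [← (hs _).2, ← hν]
      simp [q]
    obtain ⟨ρ, hρ, h1⟩ := exists_of_jumpString_getElem? H hj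
    refine ⟨(s (j + 1)).length, ?_⟩
    rw [← hseg]
    exact hH _ _ _ hρ h1

end JumpTree

/-! ### Increasing maps and exponentiation -/

namespace CodedLinearOrder

open Encodable

/-- `h` is a primitive recursive strictly increasing map from `X` to `Y`. -/
structure IsPrimrecEmbedding (X Y : CodedLinearOrder) (h : ℕ → ℕ) : Prop where
  primrec : Primrec h
  mem : ∀ x ∈ X.carrier, h x ∈ Y.carrier
  lt : ∀ x y, X.lt x y → Y.lt (h x) (h y)

theorem IsPrimrecEmbedding.omegaExp {X Y : CodedLinearOrder} {h : ℕ → ℕ}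
    (H : IsPrimrecEmbedding X Y h) : IsPrimrecEmbedding X.omegaExp Y.omegaExp
      fun a => encode ((Denumerable.ofNat (List ℕ) a).map h) := by
  have hle (x y : ℕ) (hxy : X.le x y) : Y.le (h x) (h y) := by
    by_cases e : x = y
    · exact e ▸ Y.le_refl _ (H.mem _ (X.mem_of_le _ _ hxy).1)
    · exact (H.lt _ _ ⟨hxy, e⟩).1
  have hstr (l : List ℕ) (hl : X.IsOmegaString l) : Y.IsOmegaString (l.map h) := by
    refine ⟨?_, ?_⟩
    · intro x hx
      obtain ⟨y, hy, rfl⟩ := List.mem_map.1 hx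
      exact H.mem _ (hl.1 _ hy)
    · rw [List.pairwise_map]
      exact hl.2.imp fun {a b} h' => hle b a h'
  have hlex (l l' : List ℕ) (hl : List.Lex X.lt l l') :
      List.Lex Y.lt (l.map h) (l'.map h) := by
    induction hl with
    | nil => exact .nil
    | cons _ ih => exact .cons ih
    | rel h' => exact .rel (H.lt _ _ h')
  refine ⟨Primrec.encode.comp (Primrec.list_map (Primrec.ofNat _) (H.primrec.comp Primrec.snd)),
    ?_, ?_⟩
  · intro a ha
    show Y.IsOmegaString _
    rw [Denumerable.ofNat_encode]
    exact hstr _ ha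
  · rintro a b ⟨⟨ha, hb, hab⟩, hne⟩
    have h' := hlex _ _ (hab.resolve_left hne)
    refine ⟨⟨?_, ?_, Or.inr ?_⟩, fun e => ?_⟩
    · rw [Denumerable.ofNat_encode]
      exact hstr _ ha
    · rw [Denumerable.ofNat_encode]
      exact hstr _ hb
    · rwa [Denumerable.ofNat_encode, Denumerable.ofNat_encode]
    · rw [encode_injective e] at h'
      exact Y.lex_irrefl _ h'

/-- The iterate unfolds from the inside, so the induction replaces `X` and `Y` by their
exponentials. -/
theorem IsPrimrecEmbedding.iterate {X Y : CodedLinearOrder} {h : ℕ → ℕ}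
    (H : IsPrimrecEmbedding X Y h) (n : ℕ) :
    ∃ h', IsPrimrecEmbedding (CodedLinearOrder.omegaExp^[n] X)
      (CodedLinearOrder.omegaExp^[n] Y) h' := by
  induction n generalizing X Y h with
  | zero => exact ⟨h, H⟩
  | succ n ih => exact ih H.omegaExp

theorem IsPrimrecEmbedding.isDescending {X Y : CodedLinearOrder} {h : ℕ → ℕ}
    (H : IsPrimrecEmbedding X Y h) {g : ℕ → ℕ} (hg : X.IsDescending g) :
    Y.IsDescending fun k => h (g k) :=
  ⟨fun k => H.mem _ (hg.1 k), fun k => H.lt _ _ (hg.2 k)⟩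

end CodedLinearOrder

/-! ### The order of a tree inside the exponential of the order of its jump tree -/

section JumpEmbedding

open Encodable CodedLinearOrder

variable {α : Type} [Primcodable α] {r : α → α → Prop} {H : ℕ → List α → Bool}
  {T : Set (List α)}

/-- The order on the symbols of the jump tree: all `inl` symbols precede all `inr` symbols. -/
abbrev jumpOrder (r : α → α → Prop) : ℕ ⊕ α → ℕ ⊕ α → Prop := Sum.Lex (fun a b : ℕ => a < b) r

theorem primrecRel_jumpOrder (hr : PrimrecRel r) : PrimrecRel (jumpOrder r) := by
  classical
  have h : Primrec fun p : (ℕ ⊕ α) × (ℕ ⊕ α) => (Sum.casesOn p.1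
      (fun a => Sum.casesOn p.2 (fun b => decide (a < b)) fun _ => true)
      fun a => Sum.casesOn p.2 (fun _ => false) fun b => decide (r a b) : Bool) := by
    refine Primrec.sumCasesOn Primrec.fst ?_ ?_
    · refine Primrec.sumCasesOn (Primrec.snd.comp Primrec.fst) ?_ (Primrec.const true)
      exact Primrec.nat_lt.decide.comp (Primrec.snd.comp Primrec.fst) Primrec.snd
    · refine Primrec.sumCasesOn (Primrec.snd.comp Primrec.fst) (Primrec.const false) ?_
      exact hr.decide.comp (Primrec.snd.comp Primrec.fst) Primrec.snd
  refine PrimrecPred.of_eq (Primrec.eq.comp h (Primrec.const true)) ?_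
  rintro ⟨_ | _, _ | _⟩ <;> simp [jumpOrder]

variable [IsWellOrder α r]

theorem preJumpString_lt (hT : ∀ σ τ, σ <+: τ → τ ∈ T → σ ∈ T) {σ : List α} {x : α}
    (h : σ ++ [x] ∈ T) : (kbOrder (jumpOrder r) (jumpTree H T)).lt
      (encode (preJumpString H (σ ++ [x]))) (encode (jumpString H σ)) := by
  rw [kbOrder_lt]
  refine ⟨preJumpString_mem h, jumpString_mem (hT _ _ (List.prefix_append _ _) h), ?_⟩
  rw [preJumpString_concat]
  exact kbLt_append_self _ (List.cons_ne_nil _ _)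

/-- A repair turns an `inr` into an `inl` at the first changed position, and `jumpOrder` puts every
`inl` below every `inr`. -/
theorem jumpString_le {σ : List α} {x : α}
    (h : σ ++ [x] ∈ T) : (kbOrder (jumpOrder r) (jumpTree H T)).le
      (encode (jumpString H (σ ++ [x]))) (encode (preJumpString H (σ ++ [x]))) := by
  refine ⟨_, jumpString_mem h, _, preJumpString_mem h, rfl, rfl, ?_⟩
  rw [preJumpString_concat]
  rcases jumpString_concat_cases H σ x with h' | ⟨E, y, -, ⟨E', hE⟩, -, h'⟩
  · exact Or.inl h'
  · right
    rw [h', ← hE, List.append_assoc]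
    exact kbLt_append_cons _ [] E' (Sum.Lex.sep _ _)

theorem isOmegaString_jumpChain (hT : ∀ σ τ, σ <+: τ → τ ∈ T → σ ∈ T) {σ : List α}
    (h : σ ∈ T) : (kbOrder (jumpOrder r) (jumpTree H T)).IsOmegaString
      (jumpChain H σ ++ [encode (jumpString H σ)]) := by
  set X := kbOrder (jumpOrder r) (jumpTree H T)
  have hJ {σ : List α} (h : σ ∈ T) : encode (jumpString H σ) ∈ X.carrier :=
    ⟨_, jumpString_mem h, rfl⟩
  have hJ' {σ : List α} (h : σ ∈ T) : encode (preJumpString H σ) ∈ X.carrier :=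
    ⟨_, preJumpString_mem h, rfl⟩
  suffices (∀ c ∈ jumpChain H σ, X.le (encode (jumpString H σ)) c) ∧
      (jumpChain H σ).Pairwise fun x y => X.le y x by
    refine ⟨fun c hc => ?_, ?_⟩
    · rcases List.mem_append.1 hc with hc | hc
      · exact (X.mem_of_le _ _ (this.1 c hc)).2
      · rw [List.mem_singleton.1 hc]
        exact hJ h
    · rw [List.pairwise_append]
      exact ⟨this.2, List.pairwise_singleton _ _, by simpa using this.1⟩
  induction σ using List.reverseRecOn with
  | nil => simp [jumpChain, jumpState]
  | append_singleton σ x ih =>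
    obtain ⟨ih1, ih2⟩ := ih (hT _ _ (List.prefix_append _ _) h)
    have h1 := jumpString_le (H := H) (r := r) h
    have h2 := (preJumpString_lt (H := H) (r := r) hT h).1
    have h3 : ∀ c ∈ jumpChain H σ, X.le (encode (preJumpString H (σ ++ [x]))) c :=
      fun c hc => X.le_trans _ _ _ h2 (ih1 c hc)
    have h4 : ∀ c ∈ jumpChain H σ, X.le (encode (jumpString H (σ ++ [x]))) c :=
      fun c hc => X.le_trans _ _ _ h1 (h3 c hc)
    rw [jumpChain_concat]
    refine ⟨fun c hc => ?_, ?_⟩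
    · rcases List.mem_append.1 hc with hc | hc
      · exact h4 c hc
      · rcases List.mem_pair.1 hc with rfl | rfl
        · exact h1
        · exact X.le_refl _ (hJ h)
    · rw [List.pairwise_append]
      refine ⟨ih2, by simpa using h1, fun a ha b hb => ?_⟩
      rcases List.mem_pair.1 hb with rfl | rfl
      · exact h3 a ha
      · exact h4 a ha

/-- Strings with a common part have chains with a common part, and the next entry depends only on
the next symbol and is not yet repaired. -/
theorem jumpChain_append_cons (σ ρ : List α) (a : α) : ∃ l,
    jumpChain H (σ ++ a :: ρ) =
      jumpChain H σ ++ encode (preJumpString H (σ ++ [a])) :: l := by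
  induction ρ using List.reverseRecOn with
  | nil => exact ⟨_, jumpChain_concat H σ a⟩
  | append_singleton ρ x ih =>
    obtain ⟨l, hl⟩ := ih
    have e : σ ++ a :: (ρ ++ [x]) = (σ ++ a :: ρ) ++ [x] := by simp
    rw [e, jumpChain_concat, hl]
    exact ⟨_, by rw [List.append_assoc, List.cons_append]⟩

/-- The Kleene-Brouwer order of a tree embeds into the exponential of that of its jump tree. -/
theorem isPrimrecEmbedding_jumpTree (hH : Primrec₂ H) (hT : ∀ σ τ, σ <+: τ → τ ∈ T → σ ∈ T) :
    ∃ h, IsPrimrecEmbedding (kbOrder r T)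
      (kbOrder (jumpOrder r) (jumpTree H T)).omegaExp h := by
  -- Lexicographically an initial segment is smaller, whereas in the Kleene-Brouwer order it is
  -- larger. The additional last entry corrects this: against it, a proper extension has an
  -- unrepaired approximation, which is strictly lower.
  let c (σ : List α) : List ℕ := jumpChain H σ ++ [encode (jumpString H σ)]
  have hlex {σ τ : List α} (hσ : σ ∈ T) (hτ : τ ∈ T) (h : kbLt r σ τ) :
      List.Lex (kbOrder (jumpOrder r) (jumpTree H T)).lt (c σ) (c τ) := by
    rcases kbLt_cases h with ⟨a, ρ, rfl⟩ | ⟨ρ, a, b, σ', τ', hab, rfl, rfl⟩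
    · obtain ⟨l, hl⟩ := jumpChain_append_cons (H := H) τ ρ a
      simp only [c, hl, List.append_assoc]
      refine List.Lex.append_left _ (List.Lex.rel (preJumpString_lt hT ?_)) _
      exact hT _ _ (by simp) hσ
    -- At a branching the chains first differ at the unrepaired approximations, which end in `inr a`
    -- and `inr b` and so compare as `a` and `b` do. Repaired ones need not, which is why the chain
    -- records both.
    · obtain ⟨l, hl⟩ := jumpChain_append_cons (H := H) ρ σ' a
      obtain ⟨l', hl'⟩ := jumpChain_append_cons (H := H) ρ τ' b
      simp only [c, hl, hl', List.append_assoc]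
      refine List.Lex.append_left _ (List.Lex.rel (kbOrder_lt.2 ⟨preJumpString_mem ?_,
        preJumpString_mem ?_, ?_⟩)) _
      · exact hT _ _ (by simp) hσ
      · exact hT _ _ (by simp) hτ
      · rw [preJumpString_concat, preJumpString_concat]
        exact kbLt_append_cons _ [] [] (Sum.Lex.inr hab)
  let h (n : ℕ) : ℕ := encode (c ((decode n).getD []))
  have hh (σ : List α) : h (encode σ) = encode (c σ) := by simp [h]
  have hstr {σ : List α} (hσ : σ ∈ T) : encode (c σ) ∈
      (kbOrder (jumpOrder r) (jumpTree H T)).omegaExp.carrier := by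
    show IsOmegaString _ _
    rw [Denumerable.ofNat_encode]
    exact isOmegaString_jumpChain hT hσ
  refine ⟨h, ?_, ?_, ?_⟩
  · have hst := primrec_jumpState H hH
    have hc : Primrec c := Primrec.list_concat.comp
      (Primrec.snd.comp (Primrec.snd.comp (Primrec.snd.comp hst)))
      (Primrec.encode.comp (Primrec.fst.comp (Primrec.snd.comp (Primrec.snd.comp hst))))
    exact Primrec.encode.comp (hc.comp
      (Primrec.option_getD.comp Primrec.decode (Primrec.const [])))
  · rintro _ ⟨σ, hσ, rfl⟩
    rw [hh]
    exact hstr hσ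
  · rintro x y ⟨⟨σ, hσ, τ, hτ, rfl, rfl, hle⟩, hne⟩
    have hlt := hlex hσ hτ (hle.resolve_left fun e => hne (e ▸ rfl))
    rw [hh, hh]
    refine ⟨⟨hstr hσ, hstr hτ, Or.inr ?_⟩, fun e => ?_⟩
    · rwa [Denumerable.ofNat_encode, Denumerable.ofNat_encode]
    · rw [encode_injective e] at hlt
      exact lex_irrefl _ _ hlt

end JumpEmbedding

/-! ### Monotonicity of the jump, the induction and the theorem -/

theorem decidableIn_turingJump_iff {W : ℕ → ℕ} {O : Set (ℕ →. ℕ)} :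
    DecidableIn O (fun e => turingJump W e = 1) ↔ ComputableIn O (turingJump W) := by
  classical
  constructor
  · intro h
    refine ((Primrec.encode (α := Bool)).computableIn.comp h.decide).of_eq fun e => ?_
    by_cases he : ((OracleCode.ofNat e).eval W e).Dom <;> simp [turingJump, charReal, he]
  · exact fun h => (Primrec.eq.comp Primrec.id (Primrec.const 1)).decidableIn.comp h

/-- The jump is monotone with respect to Turing reducibility. -/
theorem ComputableFrom.turingJump {Y W : ℕ → ℕ} (h : ComputableFrom Y W) :
    ComputableFrom (turingJump Y) (turingJump W) := by
  obtain ⟨H, hH, -, hjump⟩ := exists_primrecRel_jump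
  refine decidableIn_turingJump_iff.1 (DecidableIn.of_iff (DecidableIn.exists_jump
    (R := fun e s => H e ((List.range s).map Y)) ?_) fun e => (hjump Y e).symm)
  exact PrimrecPred.decidableIn hH |>.comp (f := fun q : ℕ × ℕ => (q.1, (List.range q.2).map Y))
    (ComputableIn.fst.pair ((computableIn_map_range h.computableIn).comp ComputableIn.snd))

open Encodable in
/-- Trees of iterated jumps: all paths compute the `n`th jump of `Z`, but there is a `Z`-computable
descending sequence in the `n`th iterated exponential of the Kleene-Brouwer order. -/
theorem exists_jumpTree (n : ℕ) (Z : ℕ → ℕ) :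
    ∃ (α : Type) (_ : Primcodable α) (r : α → α → Prop) (_ : IsWellOrder α r)
      (T : Set (List α)), PrimrecRel r ∧ (∀ σ τ, σ <+: τ → τ ∈ T → σ ∈ T) ∧
      DecidableIn {(Z : ℕ →. ℕ)} (fun σ => σ ∈ T) ∧
      (∀ (O : Set (ℕ →. ℕ)) (Q : ℕ → α), ComputableIn O Q → (∀ k, (List.range k).map Q ∈ T) →
        ComputableIn O (turingJump^[n] Z)) ∧
      ∃ g : ℕ → ℕ, ComputableFrom g Z ∧
        (CodedLinearOrder.omegaExp^[n] (kbOrder r T)).IsDescending g := by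
  induction n with
  | zero =>
    have hinit {σ : List ℕ} (h : σ <+: (List.range σ.length).map Z) :
        σ = (List.range σ.length).map Z := h.eq_of_length (by simp)
    -- The tree has `Z` as its only path, and its ever longer initial segments descend.
    let S (k : ℕ) : List ℕ := (List.range k).map Z
    have hS_succ (k : ℕ) : S (k + 1) = S k ++ [Z k] := by simp [S, List.range_succ]
    have hS : ComputableIn {(Z : ℕ →. ℕ)} S := computableIn_map_range (computableIn_self Z)
    refine ⟨ℕ, inferInstance, (· < ·), inferInstance, {σ | σ = S σ.length}, Primrec.nat_lt, ?_,
      ?_, ?_, ?_⟩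
    · rintro σ τ hστ (hτ : τ = _)
      have h := List.prefix_iff_eq_take.1 hστ
      rw [hτ, List.take_map_range, min_eq_left hστ.length_le] at h
      exact h
    · exact Primrec.eq.decidableIn.comp
        (ComputableIn.id.pair (hS.comp Primrec.list_length.computableIn))
    · intro O Q hQ hQS
      refine hQ.of_eq fun k => ?_
      have h : (List.range (k + 1)).map Q = _ := hQS (k + 1)
      rw [List.length_map, List.length_range] at h
      have := congrArg (fun l : List ℕ => l[k]?) h
      simpa [S] using this
    · refine ⟨fun k => encode (S k), computableFrom_iff_encode.2 hS, fun k => ?_, fun k => ?_⟩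
      · exact ⟨S k, by simp [S], rfl⟩
      · refine kbOrder_lt.2 ⟨by simp [S], by simp [S], ?_⟩
        rw [hS_succ]
        exact kbLt_append_self _ (List.cons_ne_nil _ _)
  | succ n ih =>
    obtain ⟨α, _, r, _, T, hr, hT, hdec, hpath, g, hg, hgd⟩ := ih
    obtain ⟨H₀, hH₀, hmono, hjump⟩ := exists_primrecRel_jump
    classical
    let H (j : ℕ) (σ : List α) : Bool := decide (H₀ j (σ.map encode))
    have hH : Primrec₂ H := hH₀.decide.comp Primrec.fst
      (Primrec.list_map Primrec.snd (Primrec.encode.comp Primrec.snd))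
    have hHmono (j : ℕ) (σ τ : List α) (h : σ <+: τ) (hσ : H j σ = true) : H j τ = true :=
      decide_eq_true (hmono j _ _ (h.map _) (of_decide_eq_true hσ))
    refine ⟨ℕ ⊕ α, inferInstance, jumpOrder r, inferInstance, jumpTree H T,
      primrecRel_jumpOrder hr, jumpTree_prefix hT, decidableIn_jumpTree hH hdec, ?_, ?_⟩
    · intro O Q hQ hQT
      obtain ⟨P, hP, hPT, hPQ⟩ := exists_path_of_jumpTree hT hHmono hQ hQT
      rw [Function.iterate_succ_apply']
      -- `W` presents the path `P` as a real. It computes the `n`th jump of `Z`, so `W'` computes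
      -- the next one, and `Q` decides `W'` by the kind of its symbols.
      let W (k : ℕ) : ℕ := encode (P k)
      have hW : ComputableFrom (turingJump^[n] Z) W := by
        refine hpath _ P ?_ hPT
        exact computableFrom_iff_encode.1 (computableIn_self W)
      have hWQ : ComputableIn O (turingJump W) := by
        rw [← decidableIn_turingJump_iff]
        have hl : PrimrecPred fun s : ℕ ⊕ α => s.isLeft = true :=
          Primrec.eq.comp (Primrec.sumCasesOn Primrec.id (Primrec.const true).to₂
            (Primrec.const false).to₂ |>.of_eq fun s => by cases s <;> rfl) (Primrec.const true)
        refine (hl.decidableIn.comp hQ).of_iff fun j => ?_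
        rw [← hPQ, hjump]
        simp [H, W, Function.comp_def]
      exact (ComputableFrom.turingJump hW).computableIn.subst (by
        rintro _ rfl
        exact hWQ)
    · obtain ⟨h, hh⟩ := isPrimrecEmbedding_jumpTree (r := r) hH hT
      -- The target of `hh` is already an exponential, so its `n`th iterate is the `(n + 1)`st for
      -- the jump tree.
      obtain ⟨h', hh'⟩ := hh.iterate n
      refine ⟨fun k => h' (g k), hh'.primrec.computableIn.comp hg.computableIn, ?_⟩
      exact hh'.isDescending hgd

theorem mainTheorem7 (n : ℕ) (Z : ℕ → ℕ) :
    ∃ X : CodedLinearOrder,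
      X.IsComputableFrom Z ∧
      (∀ f : ℕ → ℕ, X.IsDescending f →
        ComputableFrom (turingJump^[n] Z) (turingJump f)) ∧
      ∃ g : ℕ → ℕ, ComputableFrom g Z ∧
        (CodedLinearOrder.omegaExp^[n] X).IsDescending g := by
  obtain ⟨α, _, r, _, T, hr, hT, hdec, hpath, hg⟩ := exists_jumpTree n Z
  refine ⟨kbOrder r T, isComputableFrom_kbOrder hr hdec, fun f hf => ?_, hg⟩
  obtain ⟨P, hP, hPT⟩ := exists_path_of_isDescending hT hf
  exact hpath _ P hP hPT
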